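/- Let $k$ be an algebraically closed field and let $\Lambda$ be a discrete valuation ring with maximal ideal $(p)$ which is a $k$-algebra such that $k\to\Lambda/(p)$ is bijective (for example $\Lambda=k[[T]]$ or $k[T]_{(T)}$ with $p=T$). For a partition $\mu=(\mu_1\ge\mu_2\ge\cdots)$ put $N_\mu=\bigoplus_j\Lambda/(p^{\mu_j})$; draw $\mu$ as a diagram whose $j$-th column, counted from the left, has $\mu_j$ boxes. An LR-tableau of shape $(\alpha,\beta,\gamma)$ is a sequence of partitions $\gamma=\gamma^{(0)}\subseteq\gamma^{(1)}\subseteq\cdots\subseteq\gamma^{(r)}=\beta$ (put $\gamma^{(i)}=\beta$ for $i\ge r$), in which the boxes of $\gamma^{(e)}\setminus\gamma^{(e-1)}$ carry the entry $e$, such that the number of entries $e$ is the number $\alpha'_e$ of parts of $\alpha$ that are $\ge e$, the entries are strictly increasing down each column, and to the right of each vertical line there are at least as many entries $e$ as entries $e+1$ ($e\ge 1$). For $1\le e\le f$ with $f-e+1\le n$, let $C(e,f)_n$ be the one-column tableau of height $n$ whose last $f-e+1$ boxes carry the entries $e,\dots,f$ from top to bottom; $C(1,0)_n$ is the column of $n$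 empty boxes. The union of tableaux is formed row-wise, that is, by uniting the multisets of parts of the $i$-th partitions for each $i$. For LR-tableaux $\Gamma,\widetilde\Gamma$ of the same shape $(\alpha,\beta,\gamma)$, we say that $\widetilde\Gamma$ is obtained from $\Gamma$ by an increasing box move if both are unions of columns that agree except that two columns $C(e,f)_n$, $C(e',f')_{n'}$ of $\Gamma$ are replaced by $C(e',f')_n$, $C(e,f)_{n'}$ in $\widetilde\Gamma$, where $n>n'$, $1\le e\le f$, $e<e'$, $f<f'$ and $f-e=f'-e'$ (so that the smallest entry $e$ of these two columns is in a higher position in $\widetilde\Gamma$ than in $\Gamma$). Let $\mathbb V^\beta_{\alpha,\gamma}\subset\operatorname{Hom}_k(N_\alpha,N_\beta)$ be the set of all $\Lambda$-linear monomorphisms with cokernel isomorphic to $N_\gamma$, and for an LR-tableau $\Gamma=[\gamma^{(0)},\gamma^{(1)},\dots]$ of shape $(\alpha,\beta,\gamma)$ let $\mathbb V_\Gamma$ be the subset of those $g$ which have tableau $\Gamma$, that is, $N_\beta/p^i g(N_\alpha)\cong N_{\gamma^{(i)}}$ for all $i\ge 0$. Let $\overline{\mathbb V}_\Gamma$ be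 the Zariski closure of $\mathbb V_\Gamma$ in the affine space $\operatorname{Hom}_k(N_\alpha,N_\beta)$, and write $\Gamma\prec_{\mathsf{boundary}}\widetilde\Gamma$ if $\mathbb V_{\widetilde\Gamma}\cap\overline{\mathbb V}_\Gamma\ne\emptyset$. **Theorem.** Let $\Gamma,\widetilde\Gamma$ be LR-tableaux of the same shape $(\alpha,\beta,\gamma)$. If $\widetilde\Gamma$ is obtained from $\Gamma$ by an increasing box move, then $\Gamma\prec_{\mathsf{boundary}}\widetilde\Gamma$. -/

import Mathlib

namespace BoxMove

/-! ### Partitions, tableaux, Littlewood-Richardson tableaux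

A partition is a `YoungDiagram`.  As in the pictures for nilpotent operators, the parts of the
partition are the lengths of the *columns*: the `j`-th part of `μ` is `μ.colLen j`, and
`μ.rowLen r` is the number of parts that are `> r`, that is, the number of boxes in row `r`
(rows are counted from the top, starting with `0`). -/

/-- The number of boxes with entry `e + 1` that lie in column `c` or to the right of it, in the
tableau given by the sequence `Γ` of partitions. -/
def entriesFrom (Γ : ℕ → YoungDiagram) (e c : ℕ) : ℕ :=
  (((Γ (e + 1)).cells \ (Γ e).cells).filter (fun x => c ≤ x.2)).card

/-- An LR-tableau of shape `(α, β, γ)`: an increasing sequence of partitions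
`γ = γ⁽⁰⁾ ⊆ γ⁽¹⁾ ⊆ γ⁽²⁾ ⊆ ⋯`, equal to `β` from some point on (a finite sequence is continued by
its last term).  The boxes of `γ⁽ᵉ⁺¹⁾ \ γ⁽ᵉ⁾` carry the entry `e + 1`. -/
structure LRTableau (α β γ : YoungDiagram) where
  /-- the partition `γ⁽ⁱ⁾` -/
  part : ℕ → YoungDiagram
  /-- The partitions increase; so the entries are weakly increasing in rows and columns. -/
  mono : Monotone part
  /-- The inner shape is `γ`. -/
  inner : part 0 = γ
  /-- The outer shape is `β`. -/
  outer : ∃ r, ∀ i, r ≤ i → part i = β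
  /-- The content is `α`: row `e` of `α` counts the boxes with entry `e + 1`. -/
  content : ∀ e, ((part (e + 1)).cells \ (part e).cells).card = α.rowLen e
  /-- The entries are strictly increasing in each column: a column contains at most one
  box with a given entry. -/
  col_strict : ∀ e j, (part (e + 1)).colLen j ≤ (part e).colLen j + 1
  /-- Lattice permutation property: to the right of each vertical line there are at least as many
  entries `e + 1` as there are entries `e + 2`. -/
  lattice : ∀ e c, entriesFrom part (e + 1) c ≤ entriesFrom part e c

/-! ### Columns and box moves -/

/-- The data of a column tableau `C(e,f)_n`: one column of height `n` whose last `f + 1 - e`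
boxes carry the entries `e, …, f`. -/
structure Column where
  /-- the first entry -/
  e : ℕ
  /-- the last entry -/
  f : ℕ
  /-- the height -/
  n : ℕ

namespace Column

/-- `C(e,f)_n` with `1 ≤ e ≤ f` and at least `f - e + 1` boxes, or the column
`C(1,0)_n` of `n` empty boxes. -/
def Valid (C : Column) : Prop :=
  (1 ≤ C.e ∧ C.e ≤ C.f ∧ C.f + 1 ≤ C.n + C.e) ∨ (C.e = 1 ∧ C.f = 0)

/-- The height of the `i`-th partition `γ⁽ⁱ⁾` of the column tableau `C(e,f)_n`:
it is `n - f + e - 1` for `i ≤ e - 1`, then `n - f + i` for `e - 1 ≤ i ≤ f`, and `n` for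
`i ≥ f`. -/
def height (C : Column) (i : ℕ) : ℕ :=
  C.n + max (C.e - 1) (min i C.f) - C.f

end Column

/-- The tableau given by the sequence `Γ` is the (row-wise) union of the columns in `s`: in row
`r`, the partition `γ⁽ⁱ⁾` has one box for each column whose `i`-th partition has a box in row
`r`. -/
def IsUnionOfColumns (Γ : ℕ → YoungDiagram) (s : Multiset Column) : Prop :=
  (∀ C ∈ s, C.Valid) ∧ ∀ i r, (Γ i).rowLen r = s.countP (fun C => r < C.height i)

/-- `Γ'` is obtained from `Γ` by an increasing box move: both are unions of columns which agree
except that the columns `C(e,f)_n`, `C(e',f')_{n'}` of `Γ` are replaced by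
`C(e',f')_n`, `C(e,f)_{n'}` in `Γ'`, where `n > n'`, `e < e'`, and the two columns have the same
positive number of entries.  So the smallest entry `e` moves to a higher position. -/
def IncreasingBoxMove {α β γ : YoungDiagram} (Γ Γ' : LRTableau α β γ) : Prop :=
  ∃ (s : Multiset Column) (e f e' f' n n' : ℕ),
    n' < n ∧ e ≤ f ∧ e < e' ∧ f < f' ∧ f + e' = f' + e ∧
    IsUnionOfColumns Γ.part (⟨e, f, n⟩ ::ₘ ⟨e', f', n'⟩ ::ₘ s) ∧
    IsUnionOfColumns Γ'.part (⟨e', f', n⟩ ::ₘ ⟨e, f, n'⟩ ::ₘ s)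

/-! ### Embeddings, their tableaux, and the invariant subspace variety -/

section Embeddings

variable {Λ : Type*} [CommRing Λ]

/-- The `Λ`-module `N_μ = ⨁ⱼ Λ / (p ^ μⱼ)`, where `μⱼ` runs over the parts of `μ`. -/
abbrev N (p : Λ) (μ : YoungDiagram) : Type _ :=
  (j : Fin (μ.rowLen 0)) → Λ ⧸ Ideal.span {p ^ μ.colLen j}

/-- The submodule `A ⊆ B` has the tableau given by the sequence `Γ`: for each `i`, the
partition `γ⁽ⁱ⁾` records the lengths of the indecomposable summands of `B / pⁱ A`. -/
def HasTableau (p : Λ) {B : Type*} [AddCommGroup B] [Module Λ B] (A : Submodule Λ B)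
    (Γ : ℕ → YoungDiagram) : Prop :=
  ∀ i, Nonempty ((B ⧸ (Ideal.span {p ^ i} • A)) ≃ₗ[Λ] N p (Γ i))

variable (k : Type*) [Field k] [Algebra k Λ]

/-- `𝕍^β_{α,γ}`: the set of all `f ∈ Hom_k(N_α, N_β)` which are `Λ`-linear monomorphisms with
cokernel isomorphic to `N_γ`. -/
def V (p : Λ) (α β γ : YoungDiagram) : Set (N p α →ₗ[k] N p β) :=
  {f | ∃ g : N p α →ₗ[Λ] N p β, g.restrictScalars k = f ∧ Function.Injective g ∧
    Nonempty ((N p β ⧸ LinearMap.range g) ≃ₗ[Λ] N p γ)}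

/-- `𝕍_Γ`: the set of all embeddings in `𝕍^β_{α,γ}` which have tableau `Γ`. -/
def VTableau (p : Λ) {α β γ : YoungDiagram} (Γ : LRTableau α β γ) :
    Set (N p α →ₗ[k] N p β) :=
  {f | f ∈ V k p α β γ ∧ ∃ g : N p α →ₗ[Λ] N p β, g.restrictScalars k = f ∧
    HasTableau p (LinearMap.range g) Γ.part}

end Embeddings

/-! ### Zariski closure and the boundary relation -/

/-- The algebra of polynomial functions on a `k`-vector space `W`: it is generated by the
linear forms. -/
def polynomialFunctions (k W : Type*) [Field k] [AddCommGroup W] [Module k W] :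
    Subalgebra k (W → k) :=
  Algebra.adjoin k (Set.range (fun l : Module.Dual k W => (l : W → k)))

/-- The Zariski closure of a subset `S` of a `k`-vector space `W`, regarded as an affine space. -/
def zariskiClosure (k : Type*) {W : Type*} [Field k] [AddCommGroup W] [Module k W] (S : Set W) :
    Set W :=
  {w | ∀ φ ∈ polynomialFunctions k W, (∀ s ∈ S, φ s = 0) → φ w = 0}

/-- `Γ ≺_boundary Γ'`: the set `𝕍_Γ'` meets the closure of `𝕍_Γ` in `Hom_k(N_α, N_β)`. -/
def BoundaryRel (k : Type*) [Field k] {Λ : Type*} [CommRing Λ] [Algebra k Λ] (p : Λ)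
    {α β γ : YoungDiagram} (Γ Γ' : LRTableau α β γ) : Prop :=
  (VTableau k p Γ' ∩ zariskiClosure k (VTableau k p Γ)).Nonempty

end BoxMove

namespace BoxMove

open Finset

/-! ### Free modules modulo powers of `p` -/

section PowSub

variable {Λ : Type*} [CommRing Λ]

/-! Group the columns `C(e,f)_n` of a tableau into chains, a column with `e > 1` being preceded by
one whose last entry is `e - 1`. A chain stands for a cyclic summand of `N_α`, whose generator goes
to the sum of `p^(n-f)` times the generators of its columns. If `n - f` never decreases along
chains, subtracting multiples of preceding coordinates makes the quotient by `p^i` times the image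
visibly a sum of cyclic modules, of the lengths in the `i`-th partition. As the length of that
quotient is known beforehand, a surjection onto the expected module suffices
(`inducedMap_mem_VTableau`).

Such chains come from the lattice property by Hall's theorem. A box move exchanges the heights of
two columns `X`, `X'`. At each level of the matching one of the two tableaux imposes the stronger
inequalities, so a single matching serves both (`exists_common_matching`).

Start from the chain embedding of the new tableau, which sends the chain of `X` into the summand of
length `n'` and that of `X'` into the summand of length `n`. Add `t` times the term `p^(n'-f')` by
which the chain of `X'` enters the summand of length `n'` in the old embedding. For `t ≠ 0` an
automorphism of `N_β` turns the sum into the old chain embedding with one extra summand, from the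
chain of `X` to `X'`. The inequalities for the new tableau are what is needed to absorb this
summand, so the tableau is still `Γ`. Thus a line whose points with `t ≠ 0` lie in `𝕍_Γ` passes
through `𝕍_Γ'` at `t = 0`, and `k` is infinite. -/

/-- The submodule of `Λ^ι` of all vectors whose `j`-th coordinate is divisible by `p ^ m j`. -/
def powSub (p : Λ) {ι : Type*} (m : ι → ℕ) : Submodule Λ (ι → Λ) :=
  Submodule.pi Set.univ fun j => Ideal.span {p ^ m j}

theorem mem_powSub {p : Λ} {ι : Type*} {m : ι → ℕ} {x : ι → Λ} :
    x ∈ powSub p m ↔ ∀ j, p ^ m j ∣ x j := by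
  simp [powSub, Submodule.mem_pi, Ideal.mem_span_singleton]

/-- The family `m` of natural numbers lists the parts of `μ`, up to order and zeros. -/
def Lists {ι : Type*} [Fintype ι] (m : ι → ℕ) (μ : YoungDiagram) : Prop :=
  ∀ r, #{j | r < m j} = μ.rowLen r

theorem card_filter_lt_succ {ι : Type*} [Fintype ι] (m : ι → ℕ) (w : ℕ) :
    #{j | w < m j} = #{j | w + 1 < m j} + #{j | m j = w + 1} := by
  classical
  rw [← card_union_of_disjoint]
  · congr 1
    ext j
    simp
    omega
  · rw [disjoint_filter]
    intros
    omega

theorem card_filter_eq_of_lt {ι κ : Type*} [Fintype ι] [Fintype κ] {m : ι → ℕ} {m' : κ → ℕ}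
    (h : ∀ r, #{j | r < m j} = #{j | r < m' j}) (v : ℕ) (hv : v ≠ 0) :
    #{j | m j = v} = #{j | m' j = v} := by
  obtain ⟨w, rfl⟩ := Nat.exists_eq_succ_of_ne_zero hv
  have h1 := card_filter_lt_succ m w
  have h2 := card_filter_lt_succ m' w
  have h3 := h w
  have h4 := h (w + 1)
  simp only [Nat.succ_eq_add_one]
  omega

theorem lists_colLen (μ : YoungDiagram) : Lists (fun j : Fin (μ.rowLen 0) => μ.colLen j) μ := by
  intro r
  have : (univ.filter fun j : Fin (μ.rowLen 0) => r < μ.colLen j)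
      = univ.filter fun j : Fin (μ.rowLen 0) => j.val < μ.rowLen r := by
    ext j
    simp [← YoungDiagram.mem_iff_lt_colLen, ← YoungDiagram.mem_iff_lt_rowLen]
  rw [this, Fin.card_filter_val_lt]
  exact min_eq_right (μ.rowLen_anti 0 r (Nat.zero_le r))

/-- The numbers of values `> r` determine the multiplicity of every nonzero value, so the fibres can
be matched. Zeros are dropped because they contribute only zero modules. -/
theorem exists_equiv_of_lists {ι : Type*} [Fintype ι] {m : ι → ℕ} {μ : YoungDiagram}
    (h : Lists m μ) : ∃ σ : Fin (μ.rowLen 0) ≃ {j // m j ≠ 0}, ∀ j, m (σ j) = μ.colLen j := by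
  classical
  let A : Fin (μ.rowLen 0) → ℕ := fun j => μ.colLen j
  let B : {j // m j ≠ 0} → ℕ := fun j => m j
  have hA : ∀ j, A j ≠ 0 := by
    intro j
    have : 0 < μ.colLen j := by
      rw [← YoungDiagram.mem_iff_lt_colLen, YoungDiagram.mem_iff_lt_rowLen]
      exact j.2
    exact this.ne'
  have hcard : ∀ v, Fintype.card {j // A j = v} = Fintype.card {j // B j = v} := by
    intro v
    by_cases hv : v = 0
    · subst hv
      rw [Fintype.card_eq_zero_iff.2 ⟨fun j => hA _ j.2⟩,
        Fintype.card_eq_zero_iff.2 ⟨fun j => j.1.2 j.2⟩]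
    · rw [Fintype.card_subtype, Fintype.card_subtype]
      rw [card_filter_eq_of_lt (m' := m) (fun r => (lists_colLen μ r).trans (h r).symm) v hv]
      symm
      refine card_bij (fun j _ => j.1) ?_ ?_ ?_
      · intro j hj
        simpa [B] using hj
      · intro a _ b _ hab
        exact Subtype.ext hab
      · intro b hb
        have hb' : m b = v := by simpa using hb
        exact ⟨⟨b, by omega⟩, by simpa [B] using hb', rfl⟩
  refine ⟨Equiv.ofFiberEquiv (f := A) (g := B) fun v => Fintype.equivOfCardEq (hcard v), ?_⟩
  intro j
  exact Equiv.ofFiberEquiv_map (f := A) (g := B) _ j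

theorem nonempty_equiv_of_lists (p : Λ) {ι : Type*} [Fintype ι] {m : ι → ℕ} {μ : YoungDiagram}
    (h : Lists m μ) : Nonempty (((ι → Λ) ⧸ powSub p m) ≃ₗ[Λ] N p μ) := by
  classical
  obtain ⟨σ, hσ⟩ := exists_equiv_of_lists h
  let f : (ι → Λ) →ₗ[Λ] N p μ := LinearMap.pi fun j =>
    (Submodule.mkQ (Ideal.span {p ^ μ.colLen j})) ∘ₗ LinearMap.proj (σ j).1
  have hf : Function.Surjective f := by
    intro y
    choose z hz using fun j => Submodule.mkQ_surjective _ (y j)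
    refine ⟨fun i => if hi : m i ≠ 0 then z (σ.symm ⟨i, hi⟩) else 0, ?_⟩
    funext j
    simp only [f, LinearMap.pi_apply, LinearMap.comp_apply, LinearMap.proj_apply]
    rw [dif_pos (σ j).2]
    simpa using hz j
  have hk : LinearMap.ker f = powSub p m := by
    ext x
    rw [mem_powSub, LinearMap.mem_ker, funext_iff]
    have h1 : ∀ j, f x j = 0 ↔ p ^ m (σ j) ∣ x (σ j) := by
      intro j
      rw [hσ, ← Ideal.mem_span_singleton]
      exact Submodule.Quotient.mk_eq_zero _
    constructor
    · intro hx i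
      by_cases hi : m i = 0
      · simp [hi]
      · have := (h1 (σ.symm ⟨i, hi⟩)).1 (hx _)
        simpa using this
    · intro hx j
      exact (h1 j).2 (hx _)
  exact ⟨(Submodule.quotEquivOfEq _ _ hk.symm).trans (f.quotKerEquivOfSurjective hf)⟩

/-! ### Lengths over a discrete valuation ring -/

theorem length_quotient_powSub [IsDomain Λ] [IsDiscreteValuationRing Λ] {p : Λ}
    (hp : IsLocalRing.maximalIdeal Λ = Ideal.span {p}) {ι : Type*} [Fintype ι] (m : ι → ℕ) :
    Module.length Λ ((ι → Λ) ⧸ powSub p m) = (∑ j, m j : ℕ) := by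
  classical
  rw [powSub, (Submodule.quotientPi fun j => Ideal.span {p ^ m j}).length_eq,
    Module.length_pi_of_fintype, Nat.cast_sum]
  refine sum_congr rfl fun j _ => ?_
  rw [← Ideal.span_singleton_pow, ← hp]
  exact IsDiscreteValuationRing.length_quotient_pow_maximalIdeal _ _

theorem injective_of_surjective_of_length_le {M P : Type*} [AddCommGroup M] [AddCommGroup P]
    [Module Λ M] [Module Λ P] (f : M →ₗ[Λ] P) (hf : Function.Surjective f)
    (hP : Module.length Λ P ≠ ⊤) (h : Module.length Λ M ≤ Module.length Λ P) :
    Function.Injective f := by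
  have h1 := Module.length_eq_add_of_exact (LinearMap.ker f).subtype f
    (Submodule.subtype_injective _) hf (LinearMap.exact_subtype_ker_map f)
  rw [h1] at h
  have h2 : Module.length Λ (LinearMap.ker f) = 0 := by
    have h3 : Module.length Λ (LinearMap.ker f) + Module.length Λ P ≤ 0 + Module.length Λ P := by
      simpa using h
    exact le_antisymm ((ENat.add_le_add_iff_right hP).1 h3) zero_le
  rw [Module.length_eq_zero_iff] at h2
  rw [← LinearMap.ker_eq_bot]
  exact (Submodule.subsingleton_iff_eq_bot).1 h2

end PowSub

/-! ### Counting boxes by rows -/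

theorem sum_eq_sum_card_lt {ι : Type*} [Fintype ι] (m : ι → ℕ) (R : ℕ) (hR : ∀ j, m j ≤ R) :
    ∑ j, m j = ∑ r ∈ range R, #{j | r < m j} := by
  simp only [card_filter]
  rw [sum_comm]
  refine sum_congr rfl fun j _ => ?_
  rw [← card_filter]
  have : (range R).filter (fun r => r < m j) = range (m j) := by
    ext r
    have := hR j
    simp
    omega
  rw [this, card_range]

theorem sum_min_eq_sum_card_lt {ι : Type*} [Fintype ι] (m : ι → ℕ) (R : ℕ) :
    ∑ j, min R (m j) = ∑ r ∈ range R, #{j | r < m j} := by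
  rw [sum_eq_sum_card_lt (fun j => min R (m j)) R fun j => min_le_left _ _]
  refine sum_congr rfl fun r hr => ?_
  congr 1
  ext j
  simp at hr
  simp [hr]

theorem card_cells_rows (μ : YoungDiagram) (R : ℕ) :
    #(μ.cells.filter fun x => x.1 < R) = ∑ r ∈ range R, μ.rowLen r := by
  rw [card_eq_sum_card_fiberwise (f := Prod.fst) (t := range R)]
  · refine sum_congr rfl fun r hr => ?_
    rw [μ.rowLen_eq_card]
    congr 1
    ext x
    simp only [mem_filter, YoungDiagram.mem_row_iff, YoungDiagram.mem_cells]
    simp at hr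
    grind
  · intro x hx
    simp at hx
    simpa using hx.2

theorem card_eq_sum_rowLen (μ : YoungDiagram) (R : ℕ) (hR : μ.colLen 0 ≤ R) :
    #μ.cells = ∑ r ∈ range R, μ.rowLen r := by
  rw [← card_cells_rows, filter_true_of_mem]
  intro x hx
  have : (x.1, x.2) ∈ μ := hx
  rw [YoungDiagram.mem_iff_lt_colLen] at this
  exact this.trans_le ((μ.colLen_anti 0 x.2 (Nat.zero_le _)).trans hR)

theorem Lists.sum_min {ι : Type*} [Fintype ι] {m : ι → ℕ} {μ : YoungDiagram} (h : Lists m μ)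
    (R : ℕ) : ∑ j, min R (m j) = #(μ.cells.filter fun x => x.1 < R) := by
  rw [sum_min_eq_sum_card_lt, card_cells_rows]
  exact sum_congr rfl fun r _ => h r

theorem Lists.sum_eq {ι : Type*} [Fintype ι] {m : ι → ℕ} {μ : YoungDiagram} (h : Lists m μ) :
    ∑ j, m j = #μ.cells := by
  let R := max (univ.sup m) (μ.colLen 0)
  rw [sum_eq_sum_card_lt m R fun j => (le_sup (mem_univ j)).trans (le_max_left _ _),
    card_eq_sum_rowLen μ R (le_max_right _ _)]
  exact sum_congr rfl fun r _ => h r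

theorem LRTableau.cells_subset {α β γ : YoungDiagram} (Γ : LRTableau α β γ) {i j : ℕ}
    (h : i ≤ j) : (Γ.part i).cells ⊆ (Γ.part j).cells :=
  YoungDiagram.cells_subset_iff.2 (Γ.mono h)

theorem LRTableau.card_add_sum {α β γ : YoungDiagram} (Γ : LRTableau α β γ) (i R : ℕ) :
    #(Γ.part i).cells + ∑ r ∈ range R, α.rowLen (i + r) = #(Γ.part (i + R)).cells := by
  induction R with
  | zero => simp
  | succ R ih =>
    rw [sum_range_succ, ← add_assoc, ih, ← Γ.content, add_comm,
      card_sdiff_add_card_eq_card (Γ.cells_subset (Nat.le_succ _))]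
    rfl

/-- The boxes of `β` outside `γ⁽ⁱ⁾` are those with entry above `i`; a part `L t` of `α` accounts for
`L t - i` of them, truncated at zero. -/
theorem LRTableau.card_add_sum_sub {α β γ : YoungDiagram} (Γ : LRTableau α β γ) {τ : Type*}
    [Fintype τ] {L : τ → ℕ} (hL : Lists L α) (i : ℕ) :
    #(Γ.part i).cells + ∑ t, (L t - i) = #β.cells := by
  obtain ⟨r, hr⟩ := Γ.outer
  let R := max (univ.sup L) r
  have hR : ∀ t, L t - i ≤ R := fun t =>
    (Nat.sub_le _ _).trans ((le_sup (f := L) (mem_univ t)).trans (le_max_left _ _))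
  have hβ := hr (i + R) ((le_max_right _ _).trans (Nat.le_add_left _ _))
  rw [sum_eq_sum_card_lt _ R hR, ← congrArg YoungDiagram.cells hβ, ← Γ.card_add_sum]
  congr 1
  refine sum_congr rfl fun s _ => ?_
  rw [← hL]
  congr 1
  ext t
  simp
  omega

/-! ### A criterion for embeddings to have a given tableau -/

section Criterion

variable {Λ : Type*} [CommRing Λ] {p : Λ} {α β γ : YoungDiagram} {τ ι : Type*} {L : τ → ℕ}
  {n : ι → ℕ}

/-- The map `N_α → N_β` given by a matrix, with respect to identifications of `N_α` and `N_β` with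
quotients of free modules. -/
def inducedMap (φ : N p α ≃ₗ[Λ] (τ → Λ) ⧸ powSub p L) (χ : N p β ≃ₗ[Λ] (ι → Λ) ⧸ powSub p n)
    (G : (τ → Λ) →ₗ[Λ] (ι → Λ)) (hG : powSub p L ≤ (powSub p n).comap G) :
    N p α →ₗ[Λ] N p β :=
  χ.symm.toLinearMap ∘ₗ (powSub p L).mapQ (powSub p n) G hG ∘ₗ φ.toLinearMap

theorem inducedMap_injective (φ : N p α ≃ₗ[Λ] (τ → Λ) ⧸ powSub p L)
    (χ : N p β ≃ₗ[Λ] (ι → Λ) ⧸ powSub p n) (G : (τ → Λ) →ₗ[Λ] (ι → Λ))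
    (hG : powSub p L ≤ (powSub p n).comap G) (hG' : (powSub p n).comap G ≤ powSub p L) :
    Function.Injective (inducedMap φ χ G hG) := by
  have : Function.Injective ((powSub p L).mapQ (powSub p n) G hG) := by
    rw [← LinearMap.ker_eq_bot, Submodule.ker_mapQ, le_antisymm hG' hG, Submodule.mkQ_map_self]
  exact χ.symm.injective.comp (this.comp φ.injective)

variable [IsDomain Λ] [IsDiscreteValuationRing Λ]

theorem ne_zero_of_maximalIdeal_eq (hp : IsLocalRing.maximalIdeal Λ = Ideal.span {p}) : p ≠ 0 := by
  rintro rfl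
  apply IsDiscreteValuationRing.not_a_field Λ
  simpa using hp

theorem length_N (hp : IsLocalRing.maximalIdeal Λ = Ideal.span {p}) (μ : YoungDiagram) :
    Module.length Λ (N p μ) = #μ.cells := by
  obtain ⟨e⟩ := nonempty_equiv_of_lists p (lists_colLen μ)
  rw [← e.length_eq, length_quotient_powSub hp, (lists_colLen μ).sum_eq]

theorem length_smul_range (hp : IsLocalRing.maximalIdeal Λ = Ideal.span {p}) [Fintype τ]
    {M : Type*} [AddCommGroup M] [Module Λ M] (φ : N p α ≃ₗ[Λ] (τ → Λ) ⧸ powSub p L)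
    (g : N p α →ₗ[Λ] M) (hg : Function.Injective g) (i : ℕ) :
    Module.length Λ (Ideal.span {p ^ i} • LinearMap.range g : Submodule Λ M)
      = (∑ t, (L t - i) : ℕ) := by
  let f : (τ → Λ) →ₗ[Λ] M := g ∘ₗ φ.symm.toLinearMap ∘ₗ (powSub p L).mkQ ∘ₗ
    (p ^ i • LinearMap.id)
  have hr : LinearMap.range f = Ideal.span {p ^ i} • LinearMap.range g := by
    ext y
    rw [Submodule.ideal_span_singleton_smul, Submodule.mem_smul_pointwise_iff_exists]
    constructor
    · rintro ⟨x, rfl⟩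
      refine ⟨g (φ.symm ((powSub p L).mkQ x)), ⟨_, rfl⟩, ?_⟩
      simp only [f, LinearMap.comp_apply, LinearMap.smul_apply, LinearMap.id_apply, map_smul,
        LinearEquiv.coe_coe]
    · rintro ⟨_, ⟨x, rfl⟩, rfl⟩
      obtain ⟨z, hz⟩ := Submodule.mkQ_surjective _ (φ x)
      refine ⟨z, ?_⟩
      simp only [f, LinearMap.comp_apply, LinearMap.smul_apply, LinearMap.id_apply, map_smul,
        LinearEquiv.coe_coe, hz, LinearEquiv.symm_apply_apply]
  have hk : LinearMap.ker f = powSub p fun t => L t - i := by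
    ext x
    have h1 : f x = g (φ.symm ((powSub p L).mkQ (p ^ i • x))) := rfl
    rw [LinearMap.mem_ker, h1, map_eq_zero_iff g hg, LinearEquiv.map_eq_zero_iff,
      Submodule.mkQ_apply, Submodule.Quotient.mk_eq_zero, mem_powSub, mem_powSub]
    refine forall_congr' fun t => ?_
    have hp0 := pow_ne_zero i (ne_zero_of_maximalIdeal_eq hp)
    rw [Pi.smul_apply, smul_eq_mul]
    rcases le_total i (L t) with h | h
    · rw [← mul_dvd_mul_iff_left hp0 (b := p ^ (L t - i)), ← pow_add, Nat.add_sub_cancel' h]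
    · rw [Nat.sub_eq_zero_of_le h, pow_zero]
      exact iff_of_true ((pow_dvd_pow p h).mul_right _) (one_dvd _)
  rw [← hr, ← f.quotKerEquivRange.length_eq, hk, length_quotient_powSub hp]

/-- The map `T` induces a surjection from `N_β / pⁱ A` onto the module of the partition `γ⁽ⁱ⁾`. Both
sides have length `#γ⁽ⁱ⁾`: on the left `pⁱ A` has length `∑ (L t - i)`, which is the number of boxes
of `β` outside `γ⁽ⁱ⁾`. Hence the surjection is bijective. -/
theorem inducedMap_mem_VTableau (k : Type*) [Field k] [Algebra k Λ]
    (hp : IsLocalRing.maximalIdeal Λ = Ideal.span {p}) (Γ : LRTableau α β γ) [Fintype τ]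
    [Fintype ι] (hL : Lists L α) (φ : N p α ≃ₗ[Λ] (τ → Λ) ⧸ powSub p L)
    (χ : N p β ≃ₗ[Λ] (ι → Λ) ⧸ powSub p n) (G : (τ → Λ) →ₗ[Λ] (ι → Λ))
    (hG : powSub p L ≤ (powSub p n).comap G) (hG' : (powSub p n).comap G ≤ powSub p L)
    (hT : ∀ i, ∃ h : ι → ℕ, Lists h (Γ.part i) ∧ ∃ T : (ι → Λ) →ₗ[Λ] (ι → Λ),
      Function.Surjective T ∧ powSub p n ≤ (powSub p h).comap T ∧
      ∀ x, p ^ i • T (G x) ∈ powSub p h) :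
    (inducedMap φ χ G hG).restrictScalars k ∈ VTableau k p Γ := by
  set g := inducedMap φ χ G hG with hg
  have hginj : Function.Injective g := inducedMap_injective φ χ G hG hG'
  have htab : HasTableau p (LinearMap.range g) Γ.part := by
    intro i
    obtain ⟨h, hh, T, hTs, hTn, hTG⟩ := hT i
    obtain ⟨e⟩ := nonempty_equiv_of_lists p hh
    let ψ : N p β →ₗ[Λ] (ι → Λ) ⧸ powSub p h :=
      (powSub p n).mapQ (powSub p h) T hTn ∘ₗ χ.toLinearMap
    have hψ : Function.Surjective ψ := by
      intro y
      obtain ⟨z, rfl⟩ := Submodule.mkQ_surjective _ y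
      obtain ⟨x, rfl⟩ := hTs z
      refine ⟨χ.symm ((powSub p n).mkQ x), ?_⟩
      simp only [ψ, LinearMap.comp_apply, LinearEquiv.coe_coe, LinearEquiv.apply_symm_apply]
      rfl
    have hle : Ideal.span {p ^ i} • LinearMap.range g ≤ LinearMap.ker ψ := by
      rw [Submodule.ideal_span_singleton_smul]
      intro y hy
      rw [Submodule.mem_smul_pointwise_iff_exists] at hy
      obtain ⟨_, ⟨x, rfl⟩, rfl⟩ := hy
      obtain ⟨z, hz⟩ := Submodule.mkQ_surjective _ (φ x)
      rw [LinearMap.mem_ker, map_smul]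
      have : ψ (g x) = (powSub p h).mkQ (T (G z)) := by
        simp only [ψ, hg, inducedMap, LinearMap.comp_apply, LinearEquiv.coe_coe,
          LinearEquiv.apply_symm_apply, ← hz]
        rfl
      rw [this, ← map_smul, Submodule.mkQ_apply, Submodule.Quotient.mk_eq_zero]
      exact hTG z
    let ψ' := (Ideal.span {p ^ i} • LinearMap.range g).liftQ ψ hle
    have hψ' : Function.Surjective ψ' := fun y => by
      obtain ⟨x, rfl⟩ := hψ y
      exact ⟨Submodule.Quotient.mk x, rfl⟩
    have hlenP : Module.length Λ ((ι → Λ) ⧸ powSub p h) = #(Γ.part i).cells := by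
      rw [length_quotient_powSub hp, hh.sum_eq]
    have hlen := Module.length_eq_add_of_exact
      (Ideal.span {p ^ i} • LinearMap.range g : Submodule Λ (N p β)).subtype
      (Ideal.span {p ^ i} • LinearMap.range g : Submodule Λ (N p β)).mkQ
      (Submodule.subtype_injective _) (Submodule.mkQ_surjective _)
      (LinearMap.exact_subtype_mkQ _)
    rw [length_smul_range hp φ g hginj, length_N hp, ← Γ.card_add_sum_sub hL i, Nat.cast_add,
      add_comm] at hlen
    have hinj : Function.Injective ψ' := by
      refine injective_of_surjective_of_length_le ψ' hψ' ?_ ?_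
      · rw [hlenP]
        exact ENat.natCast_ne_top _
      · rw [hlenP]
        exact (ENat.add_right_injective_of_ne_top (ENat.natCast_ne_top _) hlen).symm.le
    exact ⟨(LinearEquiv.ofBijective ψ' ⟨hinj, hψ'⟩).trans e⟩
  refine ⟨⟨g, rfl, hginj, ?_⟩, g, rfl, htab⟩
  have h0 := htab 0
  rw [Γ.inner] at h0
  obtain ⟨e⟩ := h0
  refine ⟨(Submodule.quotEquivOfEq _ _ ?_).trans e⟩
  -- The cokernel condition is the tableau condition at `i = 0`.
  rw [pow_zero, Ideal.span_singleton_one, Submodule.top_smul]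

end Criterion

/-! ### Zariski closure of a punctured line -/

theorem exists_polynomial_of_mem_polynomialFunctions {k W : Type*} [Field k] [AddCommGroup W]
    [Module k W] {φ : W → k} (hφ : φ ∈ polynomialFunctions k W) (v w : W) :
    ∃ P : Polynomial k, ∀ t : k, φ (v + t • w) = P.eval t := by
  induction hφ using Algebra.adjoin_induction with
  | mem φ hφ =>
    obtain ⟨l, rfl⟩ := hφ
    exact ⟨Polynomial.C (l v) + Polynomial.X * Polynomial.C (l w), fun t => by simp; ring⟩
  | algebraMap r => exact ⟨Polynomial.C r, fun t => by simp⟩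
  | add φ ψ _ _ h1 h2 =>
    obtain ⟨P, hP⟩ := h1
    obtain ⟨Q, hQ⟩ := h2
    exact ⟨P + Q, fun t => by simp [hP, hQ]⟩
  | mul φ ψ _ _ h1 h2 =>
    obtain ⟨P, hP⟩ := h1
    obtain ⟨Q, hQ⟩ := h2
    exact ⟨P * Q, fun t => by simp [hP, hQ]⟩

/-- A polynomial function restricts to a one-variable polynomial on the line; vanishing at all `t ≠
0` gives it infinitely many roots. -/
theorem mem_zariskiClosure_of_punctured_line {k W : Type*} [Field k] [Infinite k]
    [AddCommGroup W] [Module k W] {S : Set W} (v w : W) (h : ∀ t : k, t ≠ 0 → v + t • w ∈ S) :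
    v ∈ zariskiClosure k S := by
  intro φ hφ hS
  obtain ⟨P, hP⟩ := exists_polynomial_of_mem_polynomialFunctions hφ v w
  have hP0 : P = 0 := by
    refine Polynomial.eq_zero_of_infinite_isRoot P ?_
    refine (Set.Finite.infinite_compl (Set.finite_singleton (0 : k))).mono fun t ht => ?_
    change P.eval t = 0
    rw [← hP]
    exact hS _ (h t ht)
  simpa [hP0] using hP 0

/-! ### Chains of columns and the embeddings they define -/

/-- `T` is unipotent for the filtration by the level `e`: `x - T x` vanishes one level further than
`x`, and there are only finitely many levels. -/
theorem surjective_of_triangular {Λ ι : Type*} [CommRing Λ] [Finite ι]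
    {T : (ι → Λ) →ₗ[Λ] (ι → Λ)} (e : ι → ℕ)
    (hT : ∀ x s, (∀ D, e D < s → x D = 0) → ∀ D, e D < s + 1 → (x - T x) D = 0) :
    Function.Surjective T := by
  obtain ⟨M, hM⟩ := (Set.finite_range e).bddAbove
  have key : ∀ b s, s + b = M + 1 → ∀ x : ι → Λ, (∀ D, e D < s → x D = 0) →
      x ∈ LinearMap.range T := by
    intro b
    induction b with
    | zero =>
      intro s hs x hx
      have : x = 0 := funext fun D => hx D (by have := hM ⟨D, rfl⟩; omega)
      rw [this]
      exact zero_mem _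
    | succ b ih =>
      intro s hs x hx
      have := add_mem (ih (s + 1) (by omega) (x - T x) (hT x s hx)) (LinearMap.mem_range_self T x)
      simpa using this
  intro x
  exact key (M + 1) 0 (by omega) x (by simp)

/-- A finite family of columns `C(e,f)_{c+f}`, grouped into chains: the column `D` belongs to the
chain `κ D` of total length `L (κ D)`, and if `1 < e D`, then it is preceded by the column
`pr D`. -/
structure ChainData (ι τ : Type*) where
  /-- first entries -/
  e : ι → ℕ
  /-- last entries -/
  f : ι → ℕ
  /-- the height of a column minus its last entry -/
  c : ι → ℕ
  /-- the preceding column -/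
  pr : ι → ι
  /-- the chain of a column -/
  κ : ι → τ
  /-- the length of a chain -/
  L : τ → ℕ
  valid : ∀ D, e D ≤ f D ∨ e D = 1
  f_pr : ∀ D, 1 < e D → f (pr D) + 1 = e D
  c_pr : ∀ D, 1 < e D → c (pr D) ≤ c D
  κ_pr : ∀ D, 1 < e D → κ (pr D) = κ D
  le_L : ∀ D, f D ≤ L (κ D)
  exists_top : ∀ t, ∃ D, κ D = t ∧ f D = L t

namespace ChainData

variable {ι τ : Type*} (C : ChainData ι τ)

/-- The heights of the columns. -/
def n (D : ι) : ℕ := C.c D + C.f D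

/-- The height of the part of the column `D` that consists of the boxes which are empty or have
entry at most `i`. -/
def h (i : ℕ) (D : ι) : ℕ := C.c D + max (C.e D - 1) (min i (C.f D))

theorem e_pr_lt {D : ι} (hD : 1 < C.e D) : C.e (C.pr D) < C.e D := by
  have h1 := C.f_pr D hD
  rcases C.valid (C.pr D) with h2 | h2 <;> omega

/-- Two columns `X`, `X'` whose entries may be swapped, where `m` is the height of `X'` minus the
last entry of `X`. -/
structure Swappable (X X' : ι) (m : ℕ) : Prop where
  e_lt : C.e X < C.e X'
  length_eq : C.f X' + C.e X = C.f X + C.e X'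
  m_add : m + C.f X = C.n X'
  pr_le : 1 < C.e X → C.c (C.pr X) ≤ m
  le_succ : ∀ D, 1 < C.e D → C.pr D = X' → C.n X ≤ C.c D + C.f X'

variable {Λ : Type*} [CommRing Λ] (p μ : Λ) [DecidableEq ι] (X X' : ι) (m : ℕ)

/-- The generator of the chain `t` maps to the sum of the `p ^ c D` times the generator of `D`,
over the columns `D` in `t`; the chain of `X` gets an additional summand at `X'`. -/
def embedding : (τ → Λ) →ₗ[Λ] (ι → Λ) :=
  LinearMap.pi fun D => p ^ C.c D • LinearMap.proj (C.κ D) +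
    (if D = X' then μ * p ^ m else 0) • LinearMap.proj (C.κ X)

/-- The change of basis which shows that the quotient modulo `p ^ i` times the image of
`embedding` is a direct sum of cyclic modules of lengths `h i`. -/
def reduction (i : ℕ) : (ι → Λ) →ₗ[Λ] (ι → Λ) :=
  LinearMap.pi fun D => LinearMap.proj D
    - (if i + 1 < C.e D then p ^ (C.c D - C.c (C.pr D)) else 0) • LinearMap.proj (C.pr D)
    + (if 1 < C.e D ∧ C.pr D = X' ∧ i < C.f X then μ * p ^ (C.c D + C.f X' - C.n X) else 0) •
        LinearMap.proj X
    - (if D = X' ∧ i + 1 < C.e X then μ * p ^ (m - C.c (C.pr X)) else 0) •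
        LinearMap.proj (C.pr X)

theorem embedding_apply (x : τ → Λ) (D : ι) :
    C.embedding p μ X X' m x D = p ^ C.c D * x (C.κ D) +
      (if D = X' then μ * p ^ m else 0) * x (C.κ X) := by
  rfl

theorem reduction_apply (i : ℕ) (x : ι → Λ) (D : ι) :
    C.reduction p μ X X' m i x D = x D
    - (if i + 1 < C.e D then p ^ (C.c D - C.c (C.pr D)) else 0) * x (C.pr D)
    + (if 1 < C.e D ∧ C.pr D = X' ∧ i < C.f X then μ * p ^ (C.c D + C.f X' - C.n X) else 0) * x X
    - (if D = X' ∧ i + 1 < C.e X then μ * p ^ (m - C.c (C.pr X)) else 0) * x (C.pr X) := by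
  rfl

/-! ### Chain embeddings with an extra summand, and their quotients -/

variable {X X' m}

theorem powSub_le_comap_embedding (hX : C.Swappable X X' m) :
    powSub p C.L ≤ (powSub p C.n).comap (C.embedding p μ X X' m) := by
  intro x hx
  rw [mem_powSub] at hx
  rw [Submodule.mem_comap, mem_powSub]
  intro D
  rw [embedding_apply]
  refine dvd_add ?_ ?_
  · rw [n, pow_add]
    exact mul_dvd_mul_left _ ((pow_dvd_pow p (C.le_L D)).trans (hx _))
  · split_ifs with hD
    · rw [hD, ← hX.m_add, pow_add, mul_assoc]
      exact dvd_mul_of_dvd_right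
        (mul_dvd_mul_left _ ((pow_dvd_pow p (C.le_L X)).trans (hx _))) _
    · simp

/-- Each coordinate `D ≠ X'` forces `p ^ f D ∣ x (κ D)`. Applied to `X`, this makes the extra
summand divisible by `p ^ n X'`, so it can be dropped at `X'`; the top column of each chain then
gives the claim. -/
theorem comap_embedding_le_powSub [IsDomain Λ] (hp : p ≠ 0) (hX : C.Swappable X X' m) :
    (powSub p C.n).comap (C.embedding p μ X X' m) ≤ powSub p C.L := by
  intro x hx
  rw [Submodule.mem_comap, mem_powSub] at hx
  simp only [embedding_apply] at hx
  rw [mem_powSub]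
  have hne : ∀ D, D ≠ X' → p ^ C.f D ∣ x (C.κ D) := by
    intro D hD
    have := hx D
    rwa [if_neg hD, zero_mul, add_zero, n, pow_add, mul_dvd_mul_iff_left (pow_ne_zero _ hp)] at this
  have hXX' : X ≠ X' := by
    rintro rfl
    exact lt_irrefl _ hX.e_lt
  have hX' : p ^ C.f X' ∣ x (C.κ X') := by
    have h1 := hx X'
    rw [if_pos rfl, mul_assoc] at h1
    have h2 : p ^ C.n X' ∣ μ * (p ^ m * x (C.κ X)) := by
      rw [← hX.m_add, pow_add]
      exact dvd_mul_of_dvd_right (mul_dvd_mul_left _ (hne X hXX')) _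
    rwa [dvd_add_left h2, n, pow_add, mul_dvd_mul_iff_left (pow_ne_zero _ hp)] at h1
  intro t
  obtain ⟨D, rfl, hD⟩ := C.exists_top t
  rw [← hD]
  by_cases h : D = X'
  · rw [h]
    exact hX'
  · exact hne D h

theorem powSub_le_comap_reduction (hX : C.Swappable X X' m) (i : ℕ) :
    powSub p C.n ≤ (powSub p (C.h i)).comap (C.reduction p μ X X' m i) := by
  intro x hx
  rw [mem_powSub] at hx
  rw [Submodule.mem_comap, mem_powSub]
  have key : ∀ D E (a : ℕ), C.h i D ≤ a + C.n E → p ^ C.h i D ∣ p ^ a * x E := by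
    intro D E a h
    refine (pow_dvd_pow p h).trans ?_
    rw [pow_add]
    exact mul_dvd_mul_left _ (hx E)
  intro D
  rw [reduction_apply]
  refine dvd_sub (dvd_add (dvd_sub ?_ ?_) ?_) ?_
  · refine (pow_dvd_pow p ?_).trans (hx D)
    have := C.valid D
    simp only [h, n]
    omega
  · split_ifs with hD
    · refine key _ _ _ ?_
      have h1 := C.f_pr D (by omega)
      have h2 := C.c_pr D (by omega)
      simp only [h, n]
      omega
    · simp
  · split_ifs with hD
    · rw [mul_assoc]
      -- The condition `i < f X` forces `i + 1 < e D`, so `h i D` is only `c D + f X'`, exactly the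
      -- available exponent.
      refine dvd_mul_of_dvd_right (key _ _ _ ?_) _
      obtain ⟨h1, h2, h3⟩ := hD
      have h4 := C.f_pr D h1
      have h5 := hX.le_succ D h1 h2
      have h6 := hX.e_lt
      have h7 := hX.length_eq
      rw [h2] at h4
      simp only [h, n] at *
      omega
    · simp
  · split_ifs with hD
    · rw [mul_assoc]
      refine dvd_mul_of_dvd_right (key _ _ _ ?_) _
      obtain ⟨rfl, h1⟩ := hD
      have h4 := C.f_pr X (by omega)
      have h5 := hX.pr_le (by omega)
      have h6 := hX.e_lt
      have h7 := hX.length_eq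
      have h8 := hX.m_add
      simp only [h, n] at *
      omega
    · simp

/-- While `i + 1 < e D`, the preceding coordinate cancels the chain term at `D`; later the factor `p
^ (i + c D)` is divisible enough. The extra summand at `X'` is cancelled through `pr X` while `i + 1
< e X`; later `p ^ (i + m)` suffices, as `X` and `X'` have equally many entries. If `X'` precedes
`D`, the subtraction carries the extra summand on to `D`: the coordinate at `X` cancels it for `i <
f X`, and otherwise it is divisible enough. -/
theorem reduction_embedding (hX : C.Swappable X X' m) (i : ℕ) (x : τ → Λ) :
    p ^ i • C.reduction p μ X X' m i (C.embedding p μ X X' m x) ∈ powSub p (C.h i) := by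
  have hXX' : X ≠ X' := by
    rintro rfl
    exact lt_irrefl _ hX.e_lt
  have hlt := hX.e_lt
  have hlen := hX.length_eq
  have hm := hX.m_add
  simp only [n] at hm
  have key : ∀ (D : ι) (y : Λ) (a b : ℕ), C.h i D ≤ i + a → b = i + a →
      p ^ C.h i D ∣ p ^ b * y := by
    rintro D y a b h rfl
    exact (pow_dvd_pow p h).mul_right _
  rw [mem_powSub]
  intro D
  rw [Pi.smul_apply, smul_eq_mul, reduction_apply]
  simp only [embedding_apply, if_neg hXX', zero_mul, add_zero]
  by_cases hD : D = X'
  · subst hD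
    have h1 : ¬ (1 < C.e D ∧ C.pr D = D ∧ i < C.f X) := by
      rintro ⟨h1, h2, -⟩
      have := C.e_pr_lt h1
      rw [h2] at this
      exact lt_irrefl _ this
    rw [if_pos rfl, if_neg h1]
    have h2 : (if i + 1 < C.e D then p ^ (C.c D - C.c (C.pr D)) else 0) *
        (p ^ C.c (C.pr D) * x (C.κ (C.pr D)) +
          (if C.pr D = D then μ * p ^ m else 0) * x (C.κ X)) =
        if i + 1 < C.e D then p ^ C.c D * x (C.κ D) else 0 := by
      split_ifs with h2 h3 h3
      · exact absurd (C.e_pr_lt (D := D) (by omega)) (by rw [h3]; exact lt_irrefl _)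
      · rw [C.κ_pr D (by omega), zero_mul, add_zero, ← mul_assoc, ← pow_add,
          Nat.sub_add_cancel (C.c_pr D (by omega))]
      · rw [zero_mul]
      · rw [zero_mul]
    have h3 : (if D = D ∧ i + 1 < C.e X then μ * p ^ (m - C.c (C.pr X)) else 0) *
        (p ^ C.c (C.pr X) * x (C.κ (C.pr X)) +
          (if C.pr X = D then μ * p ^ m else 0) * x (C.κ X)) =
        if i + 1 < C.e X then μ * p ^ m * x (C.κ X) else 0 := by
      by_cases h3 : i + 1 < C.e X
      · have h4 : C.pr X ≠ D := by
          intro h4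
          have := C.e_pr_lt (D := X) (by omega)
          rw [h4] at this
          omega
        rw [if_pos ⟨rfl, h3⟩, if_pos h3, if_neg h4, C.κ_pr X (by omega), zero_mul, add_zero,
          ← mul_assoc, mul_assoc μ, ← pow_add, Nat.sub_add_cancel (hX.pr_le (by omega))]
      · rw [if_neg (by tauto), if_neg h3, zero_mul]
    rw [h2, h3]
    have h4 : p ^ i * (p ^ C.c D * x (C.κ D) + μ * p ^ m * x (C.κ X)
        - (if i + 1 < C.e D then p ^ C.c D * x (C.κ D) else 0)
        + 0 * (p ^ C.c X * x (C.κ X))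
        - (if i + 1 < C.e X then μ * p ^ m * x (C.κ X) else 0)) =
        (if i + 1 < C.e D then 0 else p ^ (i + C.c D) * x (C.κ D)) +
        (if i + 1 < C.e X then 0 else p ^ (i + m) * (μ * x (C.κ X))) := by
      split_ifs <;> ring
    rw [h4]
    refine dvd_add ?_ ?_
    · split_ifs with h5
      · simp
      · refine key _ _ _ _ ?_ rfl
        simp only [h]
        omega
    · split_ifs with h5
      · simp
      · refine key _ _ _ _ ?_ rfl
        simp only [h]
        omega
  · rw [if_neg hD, if_neg (by tauto : ¬ (D = X' ∧ i + 1 < C.e X))]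
    by_cases h1 : i + 1 < C.e D
    · have h2 := C.c_pr D (by omega)
      have h3 := C.f_pr D (by omega)
      rw [if_pos h1, C.κ_pr D (by omega)]
      by_cases h4 : C.pr D = X'
      · have h5 := hX.le_succ D (by omega) h4
        rw [h4] at h2 h3
        simp only [n] at h5
        rw [if_pos h4, h4]
        by_cases h6 : i < C.f X
        · rw [if_pos ⟨by omega, rfl, h6⟩]
          -- Here the terms cancel completely, so the goal becomes that the expression is zero.
          refine (dvd_zero _).trans (zero_dvd_iff.2 ?_)
          have h7 : p ^ C.c D = p ^ (C.c D - C.c X') * p ^ C.c X' := by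
            rw [← pow_add, Nat.sub_add_cancel h2]
          have h8 : p ^ (C.c D + C.f X' - C.n X) * p ^ C.c X = p ^ (C.c D - C.c X') * p ^ m := by
            rw [← pow_add, ← pow_add, n]
            congr 1
            omega
          rw [h7]
          linear_combination p ^ i * μ * x (C.κ X) * h8
        · rw [if_neg (by tauto)]
          have h7 : p ^ C.c D = p ^ (C.c D - C.c X') * p ^ C.c X' := by
            rw [← pow_add, Nat.sub_add_cancel h2]
          have h8 : ∀ y z w v : Λ, p ^ i * (p ^ C.c D * y + 0 * z - p ^ (C.c D - C.c X') *
              (p ^ C.c X' * y + μ * p ^ m * z) + 0 * w - 0 * v)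
              = p ^ (i + (C.c D - C.c X' + m)) * (-μ * z) := by
            intro y z w v
            rw [h7]
            ring
          rw [h8]
          refine key _ _ _ _ ?_ rfl
          simp only [h]
          omega
      · rw [if_neg h4, if_neg (by tauto)]
        refine (dvd_zero _).trans (zero_dvd_iff.2 ?_)
        have h7 : p ^ C.c D = p ^ (C.c D - C.c (C.pr D)) * p ^ C.c (C.pr D) := by
          rw [← pow_add, Nat.sub_add_cancel h2]
        rw [h7]
        ring
    · have h2 : ¬ (1 < C.e D ∧ C.pr D = X' ∧ i < C.f X) := by
        rintro ⟨h2, h3, h4⟩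
        have := C.f_pr D h2
        rw [h3] at this
        omega
      rw [if_neg h1, if_neg h2]
      have h4 : ∀ y z w : Λ, p ^ i * (p ^ C.c D * x (C.κ D) + 0 * x (C.κ X) - 0 * y + 0 * z - 0 * w)
          = p ^ (i + C.c D) * x (C.κ D) := by
        intros
        ring
      rw [h4]
      refine key _ _ _ _ ?_ rfl
      simp only [h]
      omega

theorem reduction_surjective [Finite ι] (hX : C.Swappable X X' m) (i : ℕ) :
    Function.Surjective (C.reduction p μ X X' m i) := by
  refine surjective_of_triangular C.e fun x s hx D hD => ?_
  rw [Pi.sub_apply, reduction_apply]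
  have hlt := hX.e_lt
  have hlen := hX.length_eq
  have h1 : (if i + 1 < C.e D then p ^ (C.c D - C.c (C.pr D)) else 0) * x (C.pr D) = 0 := by
    split_ifs with h
    · rw [hx (C.pr D) (by have := C.e_pr_lt (D := D) (by omega); omega), mul_zero]
    · rw [zero_mul]
  have h2 : (if 1 < C.e D ∧ C.pr D = X' ∧ i < C.f X
      then μ * p ^ (C.c D + C.f X' - C.n X) else 0) * x X = 0 := by
    split_ifs with h
    · have := C.e_pr_lt h.1
      rw [h.2.1] at this
      rw [hx X (by omega), mul_zero]
    · rw [zero_mul]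
  have h3 : (if D = X' ∧ i + 1 < C.e X then μ * p ^ (m - C.c (C.pr X)) else 0) *
      x (C.pr X) = 0 := by
    split_ifs with h
    · obtain ⟨rfl, h⟩ := h
      rw [hx (C.pr X) (by have := C.e_pr_lt (D := X) (by omega); omega), mul_zero]
    · rw [zero_mul]
  rw [h1, h2, h3]
  ring

end ChainData

/-! ### Littlewood-Richardson tableaux which are unions of columns -/

section Counting

variable {α β γ : YoungDiagram}

/-- The lattice permutation property, row by row. -/
theorem LRTableau.lattice_rows (Γ : LRTableau α β γ) (i m : ℕ) :
    #(((Γ.part (i + 2)).cells \ (Γ.part (i + 1)).cells).filter fun x => x.1 < m + 1) ≤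
      #(((Γ.part (i + 1)).cells \ (Γ.part i).cells).filter fun x => x.1 < m) := by
  set S := ((Γ.part (i + 2)).cells \ (Γ.part (i + 1)).cells).filter fun x => x.1 < m + 1 with hS
  rcases S.eq_empty_or_nonempty with h | h
  · simp [h]
  -- Take the vertical line just left of the leftmost entry `i + 2` in these rows. An entry `i + 1`
  -- to its right in row `m` or below would put `x` inside `γ⁽ⁱ⁺¹⁾`.
  obtain ⟨x, hx, hmin⟩ := S.exists_min_image Prod.snd h
  have h1 : #S ≤ entriesFrom Γ.part (i + 1) x.2 := by
    refine card_le_card fun y hy => ?_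
    have hy' := hmin y hy
    rw [hS, mem_filter] at hy
    exact mem_filter.2 ⟨hy.1, hy'⟩
  refine (h1.trans (Γ.lattice i x.2)).trans (card_le_card fun y hy => ?_)
  rw [mem_filter] at hy ⊢
  refine ⟨hy.1, ?_⟩
  rw [hS, mem_filter, mem_sdiff] at hx
  by_contra hlt
  exact hx.1.2 ((Γ.part (i + 1)).up_left_mem (by omega : x.1 ≤ y.1) hy.2 (mem_sdiff.1 hy.1).1)

variable {ι : Type*} [Fintype ι] {col : ι → Column} (Γ : LRTableau α β γ)
  (hv : ∀ C, (col C).Valid) (hU : ∀ i, Lists (fun C => (col C).height i) (Γ.part i))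

include hv hU

/-- In `C(e,f)_n` the entry `i + 1` lies in row `n - f + i`, counted from zero; comparing `min m` of
consecutive heights detects whether it is above row `m`. -/
theorem card_entries_rows (i m : ℕ) :
    #{C | (col C).e ≤ i + 1 ∧ i + 1 ≤ (col C).f ∧ (col C).n + i + 1 ≤ m + (col C).f} =
      #(((Γ.part (i + 1)).cells \ (Γ.part i).cells).filter fun x => x.1 < m) := by
  have h1 := (hU i).sum_min m
  have h2 := (hU (i + 1)).sum_min m
  have h3 : #(((Γ.part (i + 1)).cells \ (Γ.part i).cells).filter fun x => x.1 < m) +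
      #((Γ.part i).cells.filter fun x => x.1 < m) =
      #((Γ.part (i + 1)).cells.filter fun x => x.1 < m) := by
    have : ((Γ.part (i + 1)).cells \ (Γ.part i).cells).filter (fun x => x.1 < m) =
        (Γ.part (i + 1)).cells.filter (fun x => x.1 < m) \
          (Γ.part i).cells.filter (fun x => x.1 < m) := by
      ext x
      simp only [mem_filter, mem_sdiff]
      tauto
    rw [this]
    exact card_sdiff_add_card_eq_card
      (filter_subset_filter _ (Γ.cells_subset (Nat.le_succ i)))
  have h4 : #{C | (col C).e ≤ i + 1 ∧ i + 1 ≤ (col C).f ∧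
      (col C).n + i + 1 ≤ m + (col C).f} + ∑ C, min m ((col C).height i) =
      ∑ C, min m ((col C).height (i + 1)) := by
    rw [card_filter, ← sum_add_distrib]
    refine sum_congr rfl fun C _ => ?_
    have := hv C
    simp only [Column.Valid, Column.height] at *
    split_ifs <;> omega
  omega

theorem card_entries (i : ℕ) :
    #{C | (col C).e ≤ i + 1 ∧ i + 1 ≤ (col C).f} = α.rowLen i := by
  have h1 := (hU i).sum_eq
  have h2 := (hU (i + 1)).sum_eq
  have h3 := card_sdiff_add_card_eq_card (Γ.cells_subset (Nat.le_succ i))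
  have h4 : #{C | (col C).e ≤ i + 1 ∧ i + 1 ≤ (col C).f} + ∑ C, (col C).height i =
      ∑ C, (col C).height (i + 1) := by
    rw [card_filter, ← sum_add_distrib]
    refine sum_congr rfl fun C _ => ?_
    have := hv C
    simp only [Column.Valid, Column.height] at *
    split_ifs <;> omega
  have h5 := Γ.content i
  simp only [Nat.succ_eq_add_one] at h3
  omega

/-- This is Hall's condition for the chains. Columns containing both `j` and `j + 1` occur on both
sides of `lattice_rows`; cancelling them leaves columns starting with `j + 1` against columns ending
with `j`. The difference `n - f` is an integer because validity alone does not give `f ≤ n`. -/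
theorem card_starts_le_card_ends (j : ℕ) (hj : 1 ≤ j) (z : ℤ) :
    #{C | (col C).e = j + 1 ∧ ((col C).n : ℤ) - (col C).f ≤ z} ≤
      #{C | (col C).f = j ∧ ((col C).n : ℤ) - (col C).f ≤ z} := by
  classical
  by_cases hz : z + j < 0
  · rw [card_eq_zero.2]
    · exact Nat.zero_le _
    · refine filter_eq_empty_iff.2 fun C _ => ?_
      have := hv C
      simp only [Column.Valid] at this
      omega
  obtain ⟨i, rfl⟩ := Nat.exists_eq_add_of_le' hj
  obtain ⟨m, hm⟩ := Int.eq_ofNat_of_zero_le (by omega : 0 ≤ z + (i + 1 : ℕ))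
  have h := Γ.lattice_rows i m
  rw [← card_entries_rows Γ hv hU i m] at h
  have h' := card_entries_rows Γ hv hU (i + 1) (m + 1)
  rw [show i + 1 + 1 = i + 2 from rfl] at h'
  rw [← h'] at h
  have h1 : #{C | (col C).e ≤ i + 2 ∧ i + 2 ≤ (col C).f ∧ (col C).n + (i + 1) + 1 ≤ m + 1 + (col C).f}
      = #{C | (col C).e = i + 1 + 1 ∧ ((col C).n : ℤ) - (col C).f ≤ z} +
        #{C | (col C).e ≤ i + 1 ∧ i + 2 ≤ (col C).f ∧ (col C).n + i + 1 ≤ m + (col C).f} := by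
    rw [← card_union_of_disjoint]
    · congr 1
      ext C
      have := hv C
      simp only [Column.Valid, mem_filter_univ, mem_union] at *
      omega
    · rw [disjoint_filter]
      intros
      omega
  have h2 : #{C | (col C).e ≤ i + 1 ∧ i + 1 ≤ (col C).f ∧ (col C).n + i + 1 ≤ m + (col C).f}
      = #{C | (col C).f = i + 1 ∧ ((col C).n : ℤ) - (col C).f ≤ z} +
        #{C | (col C).e ≤ i + 1 ∧ i + 2 ≤ (col C).f ∧ (col C).n + i + 1 ≤ m + (col C).f} := by
    rw [← card_union_of_disjoint]
    · congr 1
      ext C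
      have := hv C
      simp only [Column.Valid, mem_filter_univ, mem_union] at *
      omega
    · rw [disjoint_filter]
      intros
      omega
  omega

end Counting

/-! ### Matching columns into chains -/

/-- Going back along a chain does not increase `c` and ends at a column with first entry at most
`1`. Applied to `n - f`, it makes the later subtractions in `ℕ` genuine. -/
theorem nonneg_of_pred {ι : Type*} {e f : ι → ℕ} {pr : ι → ι}
    (hpr : ∀ C, 1 < e C → f (pr C) + 1 = e C) (hv : ∀ C, e C ≤ f C ∨ e C = 1) {c : ι → ℤ}
    (hc : ∀ C, 1 < e C → c (pr C) ≤ c C) (h1 : ∀ C, e C ≤ 1 → 0 ≤ c C) (C : ι) : 0 ≤ c C := by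
  induction hn : e C using Nat.strong_induction_on generalizing C with
  | _ m ih =>
    by_cases h : 1 < e C
    · refine (ih (e (pr C)) ?_ (pr C) rfl).trans (hc C h)
      have := hpr C h
      have := hv (pr C)
      omega
    · exact h1 C (by omega)

section Matching

variable {ι : Type*} [Fintype ι] (e f : ι → ℕ)

theorem exists_matching_level (c : ι → ℤ) (j : ℕ)
    (H : ∀ z, #{C | e C = j + 1 ∧ c C ≤ z} ≤ #{C | f C = j ∧ c C ≤ z}) :
    ∃ pr : ι → ι, Set.InjOn pr {C | e C = j + 1} ∧
      ∀ C, e C = j + 1 → f (pr C) = j ∧ c (pr C) ≤ c C := by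
  classical
  let t : {C // e C = j + 1} → Finset ι := fun C => {D | f D = j ∧ c D ≤ c C}
  have hall : ∀ s : Finset {C // e C = j + 1}, #s ≤ #(s.biUnion t) := by
    intro s
    rcases s.eq_empty_or_nonempty with rfl | hs
    · simp
    -- The candidate sets are nested by `c`, so the largest one already contains enough elements.
    obtain ⟨C, hC, hmax⟩ := s.exists_max_image (fun C => c C.1) hs
    calc #s = #(s.map (Function.Embedding.subtype _)) := (card_map _).symm
      _ ≤ #{D | e D = j + 1 ∧ c D ≤ c C} := by
        refine card_le_card fun D hD => ?_
        obtain ⟨E, hE, rfl⟩ := mem_map.1 hD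
        exact mem_filter.2 ⟨mem_univ _, E.2, hmax E hE⟩
      _ ≤ #{D | f D = j ∧ c D ≤ c C} := H _
      _ ≤ #(s.biUnion t) := card_le_card (subset_biUnion_of_mem t hC)
  obtain ⟨g, hg, hgt⟩ := (all_card_le_biUnion_card_iff_exists_injective t).1 hall
  refine ⟨fun C => if h : e C = j + 1 then g ⟨C, h⟩ else C, ?_, ?_⟩
  · intro C hC D hD hCD
    simp only [Set.mem_ofPred_eq] at hC hD
    simp only [dif_pos hC, dif_pos hD] at hCD
    exact congrArg Subtype.val (hg hCD)
  · intro C hC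
    simp only [dif_pos hC]
    simpa [t] using hgt ⟨C, hC⟩

/-- At each level, match for whichever of `c`, `c'` gives the stronger condition. Different levels
cannot collide, since `f (pr C)` determines the level. -/
theorem exists_common_matching (c c' : ι → ℤ)
    (H : ∀ j, 1 ≤ j → ∀ z, #{C | e C = j + 1 ∧ c C ≤ z} ≤ #{C | f C = j ∧ c C ≤ z})
    (H' : ∀ j, 1 ≤ j → ∀ z, #{C | e C = j + 1 ∧ c' C ≤ z} ≤ #{C | f C = j ∧ c' C ≤ z})
    (hdom : ∀ j, (∀ C D, e C = j + 1 → f D = j → c D ≤ c C → c' D ≤ c' C) ∨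
      ∀ C D, e C = j + 1 → f D = j → c' D ≤ c' C → c D ≤ c C) :
    ∃ pr : ι → ι, Set.InjOn pr {C | 1 < e C} ∧
      ∀ C, 1 < e C → f (pr C) + 1 = e C ∧ c (pr C) ≤ c C ∧ c' (pr C) ≤ c' C := by
  have hlevel : ∀ j, ∃ pr : ι → ι, 1 ≤ j → Set.InjOn pr {C | e C = j + 1} ∧
      ∀ C, e C = j + 1 → f (pr C) = j ∧ c (pr C) ≤ c C ∧ c' (pr C) ≤ c' C := by
    intro j
    by_cases hj : 1 ≤ j
    · rcases hdom j with hd | hd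
      · obtain ⟨pr, h1, h2⟩ := exists_matching_level e f c j (H j hj)
        exact ⟨pr, fun _ => ⟨h1, fun C hC => ⟨(h2 C hC).1, (h2 C hC).2,
          hd C _ hC (h2 C hC).1 (h2 C hC).2⟩⟩⟩
      · obtain ⟨pr, h1, h2⟩ := exists_matching_level e f c' j (H' j hj)
        exact ⟨pr, fun _ => ⟨h1, fun C hC => ⟨(h2 C hC).1,
          hd C _ hC (h2 C hC).1 (h2 C hC).2, (h2 C hC).2⟩⟩⟩
    · exact ⟨id, fun h => absurd h hj⟩
  choose q hq using hlevel
  have hspec : ∀ C, 1 < e C → f (q (e C - 1) C) + 1 = e C ∧ c (q (e C - 1) C) ≤ c C ∧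
      c' (q (e C - 1) C) ≤ c' C := by
    intro C hC
    have := (hq (e C - 1) (by omega)).2 C (by omega)
    refine ⟨by omega, this.2⟩
  refine ⟨fun C => q (e C - 1) C, ?_, hspec⟩
  intro C hC D hD hCD
  simp only [Set.mem_ofPred_eq] at hC hD hCD
  have h1 := (hspec C hC).1
  have h2 := (hspec D hD).1
  have h3 : e C = e D := by
    rw [← h1, ← h2, hCD]
  rw [← h3] at hCD
  refine (hq (e C - 1) (by omega)).1 ?_ ?_ hCD
  · simp only [Set.mem_ofPred_eq]
    omega
  · simp only [Set.mem_ofPred_eq]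
    omega

variable {e f} {pr : ι → ι} (hinj : Set.InjOn pr {C | 1 < e C})
  (hpr : ∀ C, 1 < e C → f (pr C) + 1 = e C) (hv : ∀ C, e C ≤ f C ∨ e C = 1)

/-- A column which does not precede another column. -/
def IsLast (e : ι → ℕ) (pr : ι → ι) (D : ι) : Prop := ∀ C, 1 < e C → pr C ≠ D

include hinj hpr hv

/-- Pass from a column to its successor until a last column is reached. The last entry grows
strictly on the way, so more steps than its maximum are enough; last columns are fixed. -/
theorem exists_chain_map : ∃ κ : ι → {D // IsLast e pr D},
    (∀ D, 1 < e D → κ (pr D) = κ D) ∧ (∀ D, f D ≤ f (κ D)) ∧ ∀ t, κ t.1 = t := by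
  classical
  have hex : ∀ D, ∃ C, (IsLast e pr D ∧ C = D) ∨ (1 < e C ∧ pr C = D) := by
    intro D
    by_cases h : IsLast e pr D
    · exact ⟨D, Or.inl ⟨h, rfl⟩⟩
    · simp only [IsLast, not_forall, not_not] at h
      obtain ⟨C, h1, h2⟩ := h
      exact ⟨C, Or.inr ⟨h1, h2⟩⟩
  choose nx hnx using hex
  have hlast : ∀ D, IsLast e pr D → nx D = D := by
    intro D hD
    rcases hnx D with h | h
    · exact h.2
    · exact absurd h.2 (hD _ h.1)
  have hpred : ∀ C, 1 < e C → nx (pr C) = C := by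
    intro C hC
    rcases hnx (pr C) with h | h
    · exact absurd rfl (h.1 C hC)
    · exact hinj h.1 hC h.2
  have hf : ∀ D, IsLast e pr D ∨ f D + 1 ≤ f (nx D) := by
    intro D
    rcases hnx D with h | h
    · exact Or.inl h.1
    · right
      have h1 := hpr _ h.1
      rw [h.2] at h1
      have := hv (nx D)
      omega
  have hf' : ∀ D, f D ≤ f (nx D) := by
    intro D
    rcases hf D with h | h
    · rw [hlast D h]
    · omega
  have hiter : ∀ m D, IsLast e pr (nx^[m] D) ∨ m ≤ f (nx^[m] D) := by
    intro m D
    induction m with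
    | zero => exact Or.inr (Nat.zero_le _)
    | succ m ih =>
      rw [Function.iterate_succ_apply']
      rcases hf (nx^[m] D) with h | h
      · left
        rwa [hlast _ h]
      · rcases ih with h' | h'
        · left
          rwa [hlast _ h']
        · right
          omega
  have hle : ∀ m D, f D ≤ f (nx^[m] D) := by
    intro m D
    induction m with
    | zero => exact le_rfl
    | succ m ih =>
      rw [Function.iterate_succ_apply']
      exact ih.trans (hf' _)
  let M := univ.sup f
  have hM : ∀ D, f D ≤ M := fun D => le_sup (mem_univ D)
  have hend : ∀ D, IsLast e pr (nx^[M + 1] D) := by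
    intro D
    rcases hiter (M + 1) D with h | h
    · exact h
    · have := hM (nx^[M + 1] D)
      omega
  refine ⟨fun D => ⟨nx^[M + 1] D, hend D⟩, fun D hD => Subtype.ext ?_, fun D => hle _ D,
    fun t => Subtype.ext ?_⟩
  · have h1 : nx^[M + 1] (pr D) = nx^[M] D := by
      rw [Function.iterate_succ_apply, hpred D hD]
    have h2 := hend (pr D)
    simp only
    rw [Function.iterate_succ_apply' nx M D, h1]
    rw [h1] at h2
    exact (hlast _ h2).symm
  · exact Function.iterate_fixed (hlast _ t.2) _

/-- Among columns with `r < f`, the ones that are not last correspond under `pr` to the columns with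
`e > r + 1`. Removing these leaves the columns containing `r + 1`, so the chain lengths list the
parts of `α`. -/
theorem card_last_eq [Fintype {D // IsLast e pr D}] (r : ℕ) :
    #{t : {D // IsLast e pr D} | r < f t} = #{C | e C ≤ r + 1 ∧ r + 1 ≤ f C} := by
  classical
  have h1 : #{t : {D // IsLast e pr D} | r < f t} = #{D | IsLast e pr D ∧ r < f D} := by
    refine card_bij (fun t _ => t.1) ?_ ?_ ?_
    · intro t ht
      simpa [t.2] using ht
    · intro a _ b _ hab
      exact Subtype.ext hab
    · intro b hb
      simp only [mem_filter_univ] at hb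
      exact ⟨⟨b, hb.1⟩, by simpa using hb.2, rfl⟩
  have h2 : #{C | r + 1 < e C} = #{D | ¬ IsLast e pr D ∧ r < f D} := by
    refine card_bij (fun C _ => pr C) ?_ ?_ ?_
    · intro C hC
      simp only [mem_filter_univ] at hC ⊢
      have := hpr C (by omega)
      exact ⟨fun h => h C (by omega) rfl, by omega⟩
    · intro C hC D hD hCD
      simp only [mem_filter_univ] at hC hD
      exact hinj (by simp only [Set.mem_ofPred_eq]; omega)
        (by simp only [Set.mem_ofPred_eq]; omega) hCD
    · intro D hD
      simp only [mem_filter_univ, IsLast, not_forall, not_not] at hD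
      obtain ⟨⟨C, hC, rfl⟩, h⟩ := hD
      have := hpr C hC
      exact ⟨C, by simp only [mem_filter_univ]; omega, rfl⟩
  have h3 : #{D | r < f D} = #{D | IsLast e pr D ∧ r < f D} + #{D | ¬ IsLast e pr D ∧ r < f D} := by
    rw [← card_union_of_disjoint]
    · congr 1
      ext D
      simp only [mem_filter_univ, mem_union]
      tauto
    · rw [disjoint_filter]
      intros
      tauto
  have h4 : #{D | r < f D} = #{C | e C ≤ r + 1 ∧ r + 1 ≤ f C} + #{C | r + 1 < e C} := by
    rw [← card_union_of_disjoint]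
    · congr 1
      ext D
      have := hv D
      simp only [mem_filter_univ, mem_union]
      omega
    · rw [disjoint_filter]
      intros
      omega
  omega

end Matching

/-! ### The degeneration -/

section Degeneration

variable {Λ : Type*} [CommRing Λ] {p : Λ} {α β γ : YoungDiagram}

theorem ChainData.inducedMap_mem_VTableau [IsDomain Λ] [IsDiscreteValuationRing Λ]
    (k : Type*) [Field k] [Algebra k Λ]
    (hp : IsLocalRing.maximalIdeal Λ = Ideal.span {p}) {ι τ : Type*} [Fintype ι] [Fintype τ]
    [DecidableEq ι] (C : ChainData ι τ) {X X' : ι} {m : ℕ} (hX : C.Swappable X X' m) (μ : Λ)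
    (Γ : LRTableau α β γ) (hL : Lists C.L α) (hh : ∀ i, Lists (C.h i) (Γ.part i)) {n : ι → ℕ}
    (Ψ : (ι → Λ) ≃ₗ[Λ] (ι → Λ)) (hΨ : ∀ x, Ψ x ∈ powSub p n ↔ x ∈ powSub p C.n)
    (φ : N p α ≃ₗ[Λ] (τ → Λ) ⧸ powSub p C.L) (χ : N p β ≃ₗ[Λ] (ι → Λ) ⧸ powSub p n)
    {G : (τ → Λ) →ₗ[Λ] (ι → Λ)} (hG : powSub p C.L ≤ (powSub p n).comap G)
    (hGΨ : ∀ x, G x = Ψ (C.embedding p μ X X' m x)) :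
    (inducedMap φ χ G hG).restrictScalars k ∈ VTableau k p Γ := by
  refine BoxMove.inducedMap_mem_VTableau k hp Γ hL φ χ G hG ?_ fun i =>
    ⟨C.h i, hh i, C.reduction p μ X X' m i ∘ₗ Ψ.symm.toLinearMap, ?_, ?_, ?_⟩
  · intro x hx
    rw [Submodule.mem_comap, hGΨ, hΨ] at hx
    exact C.comap_embedding_le_powSub p μ (ne_zero_of_maximalIdeal_eq hp) hX hx
  · exact (C.reduction_surjective p μ hX i).comp Ψ.symm.surjective
  · intro x hx
    refine C.powSub_le_comap_reduction p μ hX i ?_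
    rw [LinearEquiv.coe_coe, ← hΨ, LinearEquiv.apply_symm_apply]
    exact hx
  · intro x
    rw [hGΨ, LinearMap.comp_apply, LinearEquiv.coe_coe, LinearEquiv.symm_apply_apply]
    exact C.reduction_embedding p μ hX i x

theorem restrictScalars_inducedMap_add_smul {k : Type*} [Field k] [Algebra k Λ] {ι τ : Type*}
    {L : τ → ℕ} {n : ι → ℕ} (φ : N p α ≃ₗ[Λ] (τ → Λ) ⧸ powSub p L)
    (χ : N p β ≃ₗ[Λ] (ι → Λ) ⧸ powSub p n) {G H : (τ → Λ) →ₗ[Λ] (ι → Λ)} (t : k)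
    (hG : powSub p L ≤ (powSub p n).comap G) (hH : powSub p L ≤ (powSub p n).comap H)
    (hGH : powSub p L ≤ (powSub p n).comap (G + algebraMap k Λ t • H)) :
    (inducedMap φ χ G hG).restrictScalars k + t • (inducedMap φ χ H hH).restrictScalars k =
      (inducedMap φ χ (G + algebraMap k Λ t • H) hGH).restrictScalars k := by
  refine LinearMap.ext fun x => ?_
  obtain ⟨z, hz⟩ := Submodule.mkQ_surjective _ (φ x)
  simp only [LinearMap.add_apply, LinearMap.smul_apply, LinearMap.restrictScalars_apply,
    inducedMap, LinearMap.comp_apply, LinearEquiv.coe_coe, ← hz, Submodule.mkQ_apply,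
    Submodule.mapQ_apply, Submodule.Quotient.mk_add, Submodule.Quotient.mk_smul, map_add, map_smul]
  rw [algebraMap_smul]

/-- The linear map of `Λ^ι` which multiplies the coordinate at `X'` by `b` and the coordinate at
`X` by `-a`, and adds `c` times the coordinate at `X'` to the coordinate at `X`. -/
def shear {ι : Type*} [DecidableEq ι] (X X' : ι) (a b c : Λ) : (ι → Λ) →ₗ[Λ] (ι → Λ) :=
  LinearMap.pi fun D =>
    if D = X then -a • LinearMap.proj X + c • LinearMap.proj X'
    else if D = X' then b • LinearMap.proj X' else LinearMap.proj D

theorem shear_apply {ι : Type*} [DecidableEq ι] (X X' : ι) (a b c : Λ) (x : ι → Λ) (D : ι) :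
    shear X X' a b c x D =
      if D = X then -a * x X + c * x X' else if D = X' then b * x X' else x D := by
  rw [shear, LinearMap.pi_apply]
  split_ifs <;> simp

theorem shear_shear {ι : Type*} [DecidableEq ι] {X X' : ι} (hne : X ≠ X') {a b : Λ}
    (hab : a * b = 1) (c : Λ) (x : ι → Λ) :
    shear X X' a b c (shear X X' b a c x) = x := by
  funext D
  simp only [shear_apply, if_pos, if_neg hne.symm]
  split_ifs with h1 h2
  · subst h1
    linear_combination x D * hab
  · subst h2
    linear_combination x D * hab
  · rfl

/-- `shear` as a linear equivalence. -/
def shearEquiv {ι : Type*} [DecidableEq ι] {X X' : ι} (hne : X ≠ X') {a b : Λ}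
    (hab : a * b = 1) (c : Λ) : (ι → Λ) ≃ₗ[Λ] (ι → Λ) :=
  LinearEquiv.ofLinearMap (shear X X' a b c) (shear X X' b a c)
    (LinearMap.ext fun x => shear_shear hne hab c x)
    (LinearMap.ext fun x => shear_shear hne ((mul_comm b a).trans hab) c x)

/-- Multiplication by `p ^ (n X - n X')` maps the summand at `X'` into the longer one at `X`; this
uses that `X` is at least as high as `X'`. -/
theorem shear_mem_powSub {ι : Type*} [DecidableEq ι] {X X' : ι} {n : ι → ℕ} (h : n X' ≤ n X)
    (a b : Λ) {x : ι → Λ} (hx : x ∈ powSub p n) :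
    shear X X' a b (p ^ (n X - n X')) x ∈ powSub p n := by
  rw [mem_powSub] at *
  intro D
  rw [shear_apply]
  split_ifs with h1 h2
  · rw [h1]
    refine dvd_add (dvd_mul_of_dvd_right (hx X) _) ?_
    have : p ^ n X = p ^ (n X - n X') * p ^ n X' := by rw [← pow_add, Nat.sub_add_cancel h]
    rw [this]
    exact mul_dvd_mul_left _ (hx X')
  · rw [h2]
    exact dvd_mul_of_dvd_right (hx X') _
  · exact hx D

theorem shearEquiv_mem_powSub_iff {ι : Type*} [DecidableEq ι] {X X' : ι} (hne : X ≠ X')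
    {n : ι → ℕ} (h : n X' ≤ n X) {a b : Λ} (hab : a * b = 1) (x : ι → Λ) :
    shearEquiv hne hab (p ^ (n X - n X')) x ∈ powSub p n ↔ x ∈ powSub p n := by
  refine ⟨fun hx => ?_, shear_mem_powSub h a b⟩
  have := shear_mem_powSub h b a hx
  rwa [show shear X X' b a _ (shearEquiv hne hab _ x) = x from
    (shearEquiv hne hab (p ^ (n X - n X'))).symm_apply_apply x] at this

theorem lists_n_of_lists_height {ι : Type*} [Fintype ι] {col : ι → Column}
    (Γ : LRTableau α β γ) (hv : ∀ C, (col C).Valid)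
    (hU : ∀ i, Lists (fun C => (col C).height i) (Γ.part i)) : Lists (fun C => (col C).n) β := by
  obtain ⟨r, hr⟩ := Γ.outer
  let i := max r (univ.sup fun C => (col C).f)
  have h := hU i
  rw [hr i (le_max_left _ _)] at h
  convert h using 2 with C
  have h1 : (col C).f ≤ i :=
    (le_sup (f := fun C => (col C).f) (mem_univ C)).trans (le_max_right _ _)
  have := hv C
  simp only [Column.Valid, Column.height] at *
  omega

/-- Each index keeps its entries while `X` and `X'` exchange heights, so one set of chains, and one
presentation of `N_α`, serves both tableaux. -/
theorem boundaryRel_of_swap [IsDomain Λ] [IsDiscreteValuationRing Λ]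
    {k : Type*} [Field k] [Infinite k] [Algebra k Λ]
    (hp : IsLocalRing.maximalIdeal Λ = Ideal.span {p}) {ι : Type*} [Fintype ι] [DecidableEq ι]
    (Γ Γ' : LRTableau α β γ) (col : ι → Column) (X X' : ι) (hXf : (col X).e ≤ (col X).f)
    (he : (col X).e < (col X').e) (hf : (col X).f < (col X').f)
    (hlen : (col X').f + (col X).e = (col X).f + (col X').e) (hn : (col X').n < (col X).n)
    (hv : ∀ C, (col C).Valid) (hU : ∀ i, Lists (fun C => (col C).height i) (Γ.part i))
    (hv' : ∀ C, (Column.mk (col C).e (col C).f (col (Equiv.swap X X' C)).n).Valid)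
    (hU' : ∀ i, Lists (fun C => (Column.mk (col C).e (col C).f
      (col (Equiv.swap X X' C)).n).height i) (Γ'.part i)) :
    BoundaryRel k p Γ Γ' := by
  classical
  have hne : X ≠ X' := by
    rintro rfl
    exact lt_irrefl _ he
  let e : ι → ℕ := fun C => (col C).e
  let f : ι → ℕ := fun C => (col C).f
  let n : ι → ℕ := fun C => (col C).n
  let n' : ι → ℕ := fun C => n (Equiv.swap X X' C)
  have hnX : n' X = n X' := by simp [n']
  have hnX' : n' X' = n X := by simp [n']
  have hnD : ∀ D, D ≠ X → D ≠ X' → n' D = n D := fun D h1 h2 => by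
    simp [n', Equiv.swap_apply_of_ne_of_ne h1 h2]
  have hval : ∀ C, e C ≤ f C ∨ e C = 1 := fun C => by
    have := hv C
    simp only [Column.Valid, e, f] at *
    omega
  have he : e X < e X' := he
  have hf : f X < f X' := hf
  have hlen : f X' + e X = f X + e X' := hlen
  have hn : n X' < n X := hn
  have hXf : e X ≤ f X := hXf
  obtain ⟨pr, hinj, hpr⟩ := exists_common_matching e f (fun C => (n C : ℤ) - f C)
    (fun C => (n' C : ℤ) - f C) (card_starts_le_card_ends Γ hv hU)
    (card_starts_le_card_ends Γ' hv' hU') (by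
      intro j
      -- Passing to `Γ'` lowers `n - f` at `X` and raises it at `X'`. So the new inequalities are
      -- the stronger ones when `X` is a successor or `X'` a predecessor at this level, and the old
      -- ones are otherwise.
      by_cases hj : e X = j + 1 ∨ f X' = j
      · right
        intro C D hC hD h
        by_cases hC1 : C = X
        · subst hC1
          have h1 := hnD D (by rintro rfl; omega) (by rintro rfl; omega)
          omega
        · by_cases hC2 : C = X'
          · subst hC2
            omega
          · have h2 := hnD C hC1 hC2
            by_cases hD1 : D = X
            · subst hD1
              omega
            · by_cases hD2 : D = X'
              · subst hD2
                omega
              · have h3 := hnD D hD1 hD2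
                omega
      · left
        intro C D hC hD h
        have hC1 : C ≠ X := by
          rintro rfl
          tauto
        have hD2 : D ≠ X' := by
          rintro rfl
          tauto
        have h2 : n C ≤ n' C := by
          by_cases hC2 : C = X'
          · subst hC2
            omega
          · exact (hnD C hC1 hC2).ge
        have h3 : n' D ≤ n D := by
          by_cases hD1 : D = X
          · subst hD1
            omega
          · exact (hnD D hD1 hD2).le
        omega)
  have hprf : ∀ C, 1 < e C → f (pr C) + 1 = e C := fun C hC => (hpr C hC).1
  have hnn : ∀ C, 0 ≤ (n C : ℤ) - f C := nonneg_of_pred hprf hval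
    (fun C hC => (hpr C hC).2.1) (fun C hC => by
      have := hv C
      simp only [Column.Valid, e, f, n] at *
      omega)
  have hnn' : ∀ C, 0 ≤ (n' C : ℤ) - f C := nonneg_of_pred hprf hval
    (fun C hC => (hpr C hC).2.2) (fun C hC => by
      have := hv' C
      simp only [Column.Valid, e, f, n', n] at *
      omega)
  obtain ⟨κ, hκ, hκf, hκκ⟩ := exists_chain_map hinj hprf hval
  let C1 : ChainData ι {D // IsLast e pr D} :=
    { e := e, f := f, c := fun D => n D - f D, pr := pr, κ := κ, L := fun t => f t
      valid := hval, f_pr := hprf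
      c_pr := fun D hD => by
        have := (hpr D hD).2.1
        have := hnn D
        have := hnn (pr D)
        omega
      κ_pr := hκ, le_L := hκf, exists_top := fun t => ⟨t, hκκ t, rfl⟩ }
  let C2 : ChainData ι {D // IsLast e pr D} :=
    { e := e, f := f, c := fun D => n' D - f D, pr := pr, κ := κ, L := fun t => f t
      valid := hval, f_pr := hprf
      c_pr := fun D hD => by
        have := (hpr D hD).2.2
        have := hnn' D
        have := hnn' (pr D)
        omega
      κ_pr := hκ, le_L := hκf, exists_top := fun t => ⟨t, hκκ t, rfl⟩ }
  have hC1n : C1.n = n := funext fun D => by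
    have := hnn D
    simp only [ChainData.n, C1]
    omega
  have hC2n : C2.n = n' := funext fun D => by
    have := hnn' D
    simp only [ChainData.n, C2]
    omega
  have hprX : 1 < e X → n' (pr X) = n (pr X) := fun h => by
    have := hprf X h
    exact hnD _ (by intro h'; rw [h'] at this; omega) (by intro h'; rw [h'] at this; omega)
  have hprX' : ∀ D, 1 < e D → pr D = X' → n' D = n D := fun D h hD => by
    have := hprf D h
    rw [hD] at this
    exact hnD _ (by rintro rfl; omega) (by rintro rfl; omega)
  have a1 := hnn X
  have a2 := hnn X'
  have a3 := hnn' X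
  have a4 := hnn' X'
  -- The offset is `n - f` of `X` in `Γ'`, so the two inequalities required here are the matching
  -- inequalities for `Γ'`.
  have hX1 : C1.Swappable X X' (n X' - f X) :=
    { e_lt := he, length_eq := hlen
      m_add := by
        rw [hC1n]
        simp only [C1]
        omega
      pr_le := fun h => by
        have h1 := (hpr X h).2.2
        have h2 := hprX h
        simp only [C1]
        omega
      le_succ := fun D h hD => by
        have h1 := (hpr D h).2.2
        have h2 := hprX' D h hD
        have h3 := hnn D
        rw [hC1n]
        rw [show pr D = X' from hD] at h1
        simp only [C1]
        omega }
  have hX2 : C2.Swappable X X' (n X - f X) :=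
    { e_lt := he, length_eq := hlen
      m_add := by
        rw [hC2n]
        simp only [C2]
        omega
      pr_le := fun h => by
        have h1 := (hpr X h).2.1
        have h2 := hprX h
        simp only [C2]
        omega
      le_succ := fun D h hD => by
        have h1 := (hpr D h).2.1
        have h2 := hprX' D h hD
        have h3 := hnn D
        rw [hC2n]
        rw [show pr D = X' from hD] at h1
        simp only [C2]
        omega }
  have hL : Lists (fun t : {D // IsLast e pr D} => f t) α := fun r =>
    (card_last_eq hinj hprf hval r).trans (card_entries Γ hv hU r)
  have hh1 : ∀ i, Lists (C1.h i) (Γ.part i) := fun i => by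
    convert hU i using 2 with D
    have := hnn D
    simp only [ChainData.h, Column.height, C1, e, f, n] at *
    omega
  have hh2 : ∀ i, Lists (C2.h i) (Γ'.part i) := fun i => by
    convert hU' i using 2 with D
    have := hnn' D
    simp only [ChainData.h, Column.height, C2, e, f, n', n] at *
    omega
  obtain ⟨φ⟩ : Nonempty (N p α ≃ₗ[Λ] ({D // IsLast e pr D} → Λ) ⧸ powSub p C1.L) :=
    (nonempty_equiv_of_lists p hL).map LinearEquiv.symm
  obtain ⟨χ⟩ : Nonempty (N p β ≃ₗ[Λ] (ι → Λ) ⧸ powSub p n) :=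
    (nonempty_equiv_of_lists p (lists_n_of_lists_height Γ hv hU)).map LinearEquiv.symm
  -- The chains of `Γ'` use the exchanged heights; permuting coordinates brings them back to the
  -- fixed presentation of `N_β`.
  let S : (ι → Λ) ≃ₗ[Λ] (ι → Λ) := LinearEquiv.funCongrLeft Λ Λ (Equiv.swap X X')
  have hS : ∀ (x : ι → Λ) D, S x D = x (Equiv.swap X X' D) := fun _ _ => rfl
  let G : ({D // IsLast e pr D} → Λ) →ₗ[Λ] (ι → Λ) :=
    S.toLinearMap ∘ₗ C2.embedding p 0 X X' (n X - f X)
  let H : ({D // IsLast e pr D} → Λ) →ₗ[Λ] (ι → Λ) := LinearMap.pi fun D =>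
    (if D = X' then p ^ (n X' - f X') else 0) • LinearMap.proj (κ X')
  have hSmem : ∀ x, S x ∈ powSub p n ↔ x ∈ powSub p C2.n := by
    intro x
    rw [mem_powSub, mem_powSub, ← (Equiv.swap X X').forall_congr_right]
    refine forall_congr' fun D => ?_
    rw [hS, hC2n, Equiv.swap_apply_self]
  have hG : powSub p C1.L ≤ (powSub p n).comap G := fun x hx =>
    (hSmem _).2 (C2.powSub_le_comap_embedding p 0 hX2 hx)
  have hH : powSub p C1.L ≤ (powSub p n).comap H := by
    intro x hx
    rw [mem_powSub] at hx
    rw [Submodule.mem_comap, mem_powSub]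
    intro D
    have hHD : H x D = (if D = X' then p ^ (n X' - f X') else 0) * x (κ X') := rfl
    rw [hHD]
    split_ifs with h
    · have h1 : n D = (n X' - f X') + f X' := by
        rw [h]
        omega
      rw [h1, pow_add]
      exact mul_dvd_mul_left _ ((pow_dvd_pow p (hκf X')).trans (hx _))
    · simp
  have hGH : ∀ t : k, powSub p C1.L ≤ (powSub p n).comap (G + algebraMap k Λ t • H) :=
    fun t x hx =>
      (powSub p n).add_mem (hG hx) ((powSub p n).smul_mem (algebraMap k Λ t) (hH hx))
  refine ⟨(inducedMap φ χ G hG).restrictScalars k, ?_, ?_⟩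
  · exact C2.inducedMap_mem_VTableau k hp hX2 0 Γ' hL hh2 S hSmem φ χ hG fun x => rfl
  · refine mem_zariskiClosure_of_punctured_line _ ((inducedMap φ χ H hH).restrictScalars k)
      fun t ht => ?_
    rw [restrictScalars_inducedMap_add_smul φ χ t hG hH (hGH t)]
    have hab : algebraMap k Λ t⁻¹ * algebraMap k Λ t = 1 := by
      rw [← map_mul, inv_mul_cancel₀ ht, map_one]
    -- Scaling the coordinate at `X'` by `t` requires the extra summand to have coefficient `t⁻¹`.
    -- The shear then clears the chain of `X` from the coordinate at `X`, leaving the chain of `X'`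
    -- there as in `G`.
    refine C1.inducedMap_mem_VTableau k hp hX1 (algebraMap k Λ t⁻¹) Γ hL hh1
      (shearEquiv hne hab (p ^ (n X - n X'))) ?_ φ χ (hGH t) ?_
    · rw [hC1n]
      exact shearEquiv_mem_powSub_iff hne hn.le hab
    · intro x
      funext D
      have hl : (G + algebraMap k Λ t • H) x D = p ^ (n' (Equiv.swap X X' D) -
          f (Equiv.swap X X' D)) * x (κ (Equiv.swap X X' D)) +
          algebraMap k Λ t * ((if D = X' then p ^ (n X' - f X') else 0) * x (κ X')) := by
        have h1 : (G + algebraMap k Λ t • H) x D =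
          C2.embedding p 0 X X' (n X - f X) x (Equiv.swap X X' D) + algebraMap k Λ t *
            ((if D = X' then p ^ (n X' - f X') else 0) * x (κ X')) := rfl
        rw [h1, ChainData.embedding_apply, zero_mul, ite_self, zero_mul, add_zero]
      have hr : shearEquiv hne hab (p ^ (n X - n X'))
          (C1.embedding p (algebraMap k Λ t⁻¹) X X' (n X' - f X) x) D =
          shear X X' (algebraMap k Λ t⁻¹) (algebraMap k Λ t) (p ^ (n X - n X'))
          (C1.embedding p (algebraMap k Λ t⁻¹) X X' (n X' - f X) x) D := rfl
      rw [hl, hr, shear_apply]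
      simp only [ChainData.embedding_apply, if_neg hne, if_pos]
      by_cases h1 : D = X
      · subst h1
        rw [Equiv.swap_apply_left, if_neg hne, if_pos rfl, hnX']
        have h2 : p ^ (n D - f X') = p ^ (n D - n X') * p ^ (n X' - f X') := by
          rw [← pow_add]
          congr 1
          omega
        have h3 : p ^ (n D - f D) = p ^ (n D - n X') * p ^ (n X' - f D) := by
          rw [← pow_add]
          congr 1
          omega
        simp only [C1]
        rw [h2, h3]
        ring
      · by_cases h2 : D = X'
        · subst h2
          rw [Equiv.swap_apply_right, if_pos rfl, if_neg h1, if_pos rfl, hnX]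
          simp only [C1]
          linear_combination -p ^ (n D - f X) * x (κ X) * hab
        · rw [Equiv.swap_apply_of_ne_of_ne h1 h2, if_neg h2, if_neg h1, if_neg h2, if_neg h2,
            hnD D h1 h2]
          simp only [C1]
          ring

end Degeneration

/-! ### Enumerating the columns -/

/-- The family of columns consisting of two columns and a finite family. -/
def consCol (C C' : Column) {m : ℕ} (col : Fin m → Column) : Option (Option (Fin m)) → Column
  | none => C
  | some none => C'
  | some (some j) => col j

theorem exists_map_univ_eq {β : Type*} (s : Multiset β) :
    ∃ (m : ℕ) (g : Fin m → β), univ.val.map g = s := by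
  induction s using Quotient.inductionOn with
  | _ l => exact ⟨l.length, l.get, by rw [Fin.univ_val_map, List.ofFn_get]; rfl⟩

theorem lists_consCol {P : ℕ → YoungDiagram} {C C' : Column} {m : ℕ} {col : Fin m → Column}
    (h : IsUnionOfColumns P (C ::ₘ C' ::ₘ univ.val.map col)) :
    (∀ D, (consCol C C' col D).Valid) ∧
      ∀ i, Lists (fun D => (consCol C C' col D).height i) (P i) := by
  constructor
  · rintro (_ | _ | j)
    · exact h.1 _ (by simp [consCol])
    · exact h.1 _ (by simp [consCol])
    · exact h.1 _ (by simp [consCol])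
  · intro i r
    rw [h.2, card_filter, Fintype.sum_option, Fintype.sum_option, Multiset.countP_cons,
      Multiset.countP_cons, Multiset.countP_map,
      show Multiset.card (Multiset.filter (fun j => r < (col j).height i) univ.val) =
        #{j | r < (col j).height i} from rfl, card_filter]
    have key : ∀ a b c : ℕ, a + (b + c) = c + b + a := fun a b c => by ring
    exact key _ _ _

end BoxMove

theorem mainTheorem3
    {k : Type*} [Field k] [IsAlgClosed k]
    {Λ : Type*} [CommRing Λ] [IsDomain Λ] [IsDiscreteValuationRing Λ] [Algebra k Λ]
    (hres : Function.Bijective (algebraMap k (IsLocalRing.ResidueField Λ)))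
    (p : Λ) (hp : IsLocalRing.maximalIdeal Λ = Ideal.span {p})
    {α β γ : YoungDiagram}
    (Γ Γ' : BoxMove.LRTableau α β γ)
    (hbox : BoxMove.IncreasingBoxMove Γ Γ') :
    BoxMove.BoundaryRel k p Γ Γ' := by
  obtain ⟨s, e, f, e', f', n, n', hn, hef, he, hf, hlen, hΓ, hΓ'⟩ := hbox
  obtain ⟨m, col, rfl⟩ := BoxMove.exists_map_univ_eq s
  -- Reordered so that columns with the same entries share an index.
  rw [Multiset.cons_swap] at hΓ'
  obtain ⟨hv, hU⟩ := BoxMove.lists_consCol hΓ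
  obtain ⟨hv', hU'⟩ := BoxMove.lists_consCol hΓ'
  have : Infinite k := IsAlgClosed.instInfinite
  have hcol : ∀ D, BoxMove.consCol ⟨e, f, n'⟩ ⟨e', f', n⟩ col D =
      BoxMove.Column.mk (BoxMove.consCol ⟨e, f, n⟩ ⟨e', f', n'⟩ col D).e
        (BoxMove.consCol ⟨e, f, n⟩ ⟨e', f', n'⟩ col D).f
        (BoxMove.consCol ⟨e, f, n⟩ ⟨e', f', n'⟩ col (Equiv.swap none (some none) D)).n := by
    rintro (_ | _ | j)
    · simp [BoxMove.consCol]
    · simp [BoxMove.consCol]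
    · rw [Equiv.swap_apply_of_ne_of_ne (by simp) (by simp)]
      rfl
  simp only [hcol] at hv' hU'
  refine BoxMove.boundaryRel_of_swap hp Γ Γ' (BoxMove.consCol ⟨e, f, n⟩ ⟨e', f', n'⟩ col) none
    (some none) hef he hf ?_ hn hv hU hv' hU'
  simp only [BoxMove.consCol]
  omega
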